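/- Let $B$ be a compact smooth manifold with (possibly empty) boundary $\partial B$, let $L$ be a closed smooth manifold (compact, without boundary), and let $p : E \to B$ be a smooth fiber bundle with fiber $L$: $E$ is a smooth manifold with boundary, $p$ is smooth, and every point of $B$ has an open neighbourhood $U$ with a diffeomorphism $\phi : p^{-1}(U) \to U \times L$ satisfying $\mathrm{pr}_1 \circ \phi = p$. A (smooth, open) collar of the boundary of a manifold $M$ is a smooth embedding $c : \partial M \times [0,1) \hookrightarrow M$ onto an open subset of $M$ with $c(x,0) = x$ for all $x \in \partial M$. Collars $c_{\partial E}$ of $\partial E$ in $E$ and $c_{\partial B}$ of $\partial B$ in $B$ are called $p$-related if $p(\partial E) \subseteq \partial B$ and $$p(c_{\partial E}(e,t)) = c_{\partial B}(p(e),t) \qquad \text{for all } e \in \partial E,\ t \in [0,1).$$ Then: 1. There exist a collar $c_{\partial E} : \partial E \times [0,1) \hookrightarrow E$ and a collar $c_{\partial B} : \partial B \times [0,1) \hookrightarrow B$ that are $p$-related. 2. For every collar $c_{\partial B} : \partial B \times [0,1) \hookrightarrow B$ there exist $\alpha \in (0,1]$, a diffeomorphism $f : [0,1) \to [0,\alpha)$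 and a collar $c_{\partial E} : \partial E \times [0,1) \hookrightarrow E$ such that $(x,t) \mapsto c_{\partial B}(x, f(t))$ is a collar of $\partial B$ in $B$ and is $p$-related to $c_{\partial E}$. -/

import Mathlib

open Set
open scoped Manifold ContDiff

/-- The model `I` is a (finite- or infinite-dimensional) half-space `{v | 0 ≤ ℓ v}`, where `ℓ` is a
linear functional.  If `ℓ = 0` this is the whole vector space, so that manifolds with empty boundary
(of any dimension, including `0`) are covered.  A manifold over a finite-dimensional such model is
a manifold with (possibly empty) boundary and without corners; `𝓡∂ n` is the case where
`ℓ` is a coordinate of `ℝⁿ`. -/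
def IsHalfSpaceModel {V H : Type*} [NormedAddCommGroup V] [NormedSpace ℝ V] [TopologicalSpace H]
    (I : ModelWithCorners ℝ V H) : Prop :=
  ∃ ℓ : V →L[ℝ] ℝ, range I = {v | 0 ≤ ℓ v}

/-- `p : E → B` is a smooth fiber bundle with fiber `L`: it is smooth, and over a neighbourhood `U`
of each point of `B` there is a diffeomorphism `φ : p⁻¹(U) → U × L` with `pr₁ ∘ φ = p`.
(A `Bundle.Trivialization L p` is a homeomorphism `p⁻¹(U) → U × L` over an open set `U`, the
`baseSet`.) -/
structure IsSmoothFiberBundle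
    {V H B : Type*} [NormedAddCommGroup V] [NormedSpace ℝ V] [TopologicalSpace H]
    [TopologicalSpace B] [ChartedSpace H B]
    {V' H' E : Type*} [NormedAddCommGroup V'] [NormedSpace ℝ V'] [TopologicalSpace H']
    [TopologicalSpace E] [ChartedSpace H' E]
    {V'' H'' : Type*} [NormedAddCommGroup V''] [NormedSpace ℝ V''] [TopologicalSpace H'']
    (I : ModelWithCorners ℝ V H) (J : ModelWithCorners ℝ V' H') (K : ModelWithCorners ℝ V'' H'')
    (L : Type*) [TopologicalSpace L] [ChartedSpace H'' L] (p : E → B) : Prop where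
  contMDiff : ContMDiff J I ∞ p
  locallyTrivial : ∀ b : B, ∃ φ : Bundle.Trivialization L p, b ∈ φ.baseSet ∧
    ContMDiffOn J (I.prod K) ∞ φ φ.source ∧
    ContMDiffOn (I.prod K) J ∞ φ.toOpenPartialHomeomorph.symm φ.target

/-- The set `∂M × [0,1)`, as a subset of `M × ℝ`. -/
def collarDomain {V H : Type*} [NormedAddCommGroup V] [NormedSpace ℝ V] [TopologicalSpace H]
    (I : ModelWithCorners ℝ V H) (M : Type*) [TopologicalSpace M] [ChartedSpace H M] :
    Set (M × ℝ) :=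
  I.boundary M ×ˢ Ico (0 : ℝ) 1

/-- `c` is a smooth collar `∂M × [0,1) ↪ M` of the boundary of `M`: a diffeomorphism of
`∂M × [0,1)` onto an open subset of `M` with `c (x, 0) = x`.  Only the values of `c` on
`∂M × [0,1)` matter.  Smoothness of a map from or to `∂M × [0,1)` is smoothness with respect to this
submanifold of `M × ℝ`: a map defined on it is smooth if it is so within the subset, and a map into
it is smooth if it is so as a map into `M × ℝ`. -/
structure IsCollar {V H : Type*} [NormedAddCommGroup V] [NormedSpace ℝ V] [TopologicalSpace H]
    (I : ModelWithCorners ℝ V H) {M : Type*} [TopologicalSpace M] [ChartedSpace H M]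
    (c : M × ℝ → M) : Prop where
  apply_zero : ∀ x ∈ I.boundary M, c (x, 0) = x
  contMDiffOn : ContMDiffOn (I.prod 𝓘(ℝ, ℝ)) I ∞ c (collarDomain I M)
  isOpen_image : IsOpen (c '' collarDomain I M)
  exists_smooth_inverse : ∃ g : M → M × ℝ, LeftInvOn g c (collarDomain I M) ∧
    ContMDiffOn I (I.prod 𝓘(ℝ, ℝ)) ∞ g (c '' collarDomain I M)

/-- The collars `cE` of `∂E` and `cB` of `∂B` are `p`-related: `p` restricts to a map `∂E → ∂B`, and
`p ∘ cE = cB ∘ (p| × id)` on `∂E × [0,1)`. -/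
structure PRelated
    {V H B : Type*} [NormedAddCommGroup V] [NormedSpace ℝ V] [TopologicalSpace H]
    [TopologicalSpace B] [ChartedSpace H B]
    {V' H' E : Type*} [NormedAddCommGroup V'] [NormedSpace ℝ V'] [TopologicalSpace H']
    [TopologicalSpace E] [ChartedSpace H' E]
    (I : ModelWithCorners ℝ V H) (J : ModelWithCorners ℝ V' H') (p : E → B)
    (cE : E × ℝ → E) (cB : B × ℝ → B) : Prop where
  isCollar_total : IsCollar J cE
  isCollar_base : IsCollar I cB
  mapsTo_boundary : MapsTo p (J.boundary E) (I.boundary B)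
  comm : ∀ e ∈ J.boundary E, ∀ t ∈ Ico (0 : ℝ) 1, p (cE (e, t)) = cB (p e, t)

/-- `f` restricts to a diffeomorphism from the subset `s` of `ℝ` onto the subset `t` of `ℝ`. -/
def IsDiffeoBetween (f : ℝ → ℝ) (s t : Set ℝ) : Prop :=
  BijOn f s t ∧ ContDiffOn ℝ ∞ f s ∧ ∃ g : ℝ → ℝ, LeftInvOn g f s ∧ ContDiffOn ℝ ∞ g t

/-! Existence of a collar on `B` needs no flows. Charts, bump functions and compactness give a
smooth `r : B → B` that fixes `∂B` and maps a neighbourhood of `∂B` into `∂B`, and a smooth `s ≥ 0`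
that vanishes on `∂B` and grows there at least linearly in the boundary coordinate. By an inverse
function theorem for half-spaces, `(r, s)` is a local diffeomorphism onto `∂B × [0, ∞)` at each
boundary point. It is injective on the compact set `∂B`, hence near it, and its image contains some
`∂B × [0, ε)`; the rescaled inverse is a collar (`exists_isCollar`).

Lifting a collar `cB` uses no connection. In a local trivialization a point over `cB (x, τ x * t)`
moves to a point over `cB (x, τ' x * t)` by keeping its fibre coordinate. If `τ' = τ` outside a
closed set over which the trivialization is available, this extends smoothly by the identity.
Finitely many such moves raise `τ` from `0` to `1` on `∂B` (`exists_collarTransportable`); `α` is a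
time during which all the collar curves involved stay in their trivializing sets. As `L` has no
boundary, `∂E` is the preimage of `∂B`, so the composite move carries `∂E × [0, α)` onto the part of
`E` over the collar up to time `α`, and the reverse moves invert it. Rescaling time by `f t = α * t`
proves the second claim; applied to any collar of `B`, it gives the first. -/

open Filter Topology

/-! ### Calculus on subsets with unique derivatives -/

section InverseFunction

variable {V : Type*} [NormedAddCommGroup V] [NormedSpace ℝ V]

/-- A continuous right inverse of a smooth map with invertible derivative is smooth. -/
theorem contDiffOn_infty_of_rightInverse [CompleteSpace V] {F h : V → V} {S T : Set V}
    (hF : ContDiffOn ℝ ∞ F S) (hS : UniqueDiffOn ℝ S) (hT : UniqueDiffOn ℝ T)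
    (hc : ContinuousOn h T) (hm : MapsTo h T S) (hFh : ∀ q ∈ T, F (h q) = q)
    (hinv : ∀ v ∈ S, (fderivWithin ℝ F S v).IsInvertible) : ContDiffOn ℝ ∞ h T := by
  have hd : ∀ q ∈ T, HasFDerivWithinAt h (fderivWithin ℝ F S (h q)).inverse T q := by
    intro q hq
    obtain ⟨A, hA⟩ := hinv (h q) (hm hq)
    have h1 : HasFDerivWithinAt F (A : V →L[ℝ] V) S (h q) := by
      rw [hA]
      exact (hF.differentiableOn (by simp) _ (hm hq)).hasFDerivWithinAt
    have := HasFDerivWithinAt.of_local_left_inverse (s := T) (a := q)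
      ((hc q hq).tendsto_nhdsWithin hm) h1 hq
      (eventually_of_mem self_mem_nhdsWithin hFh)
    rw [← hA, ContinuousLinearMap.inverse_equiv]
    exact this
  have hF' : ContDiffOn ℝ ∞ (fderivWithin ℝ F S) S :=
    ((contDiffOn_infty_iff_fderivWithin hS).1 hF).2
  rw [contDiffOn_infty]
  intro n
  -- Bootstrapping: the derivative of `h` is the inverse of `F' ∘ h`, and inversion is smooth at
  -- invertible operators, so `h` gains one order of smoothness.
  induction n with
  | zero => exact contDiffOn_zero.2 hc
  | succ n ih =>
    have := (contDiffOn_succ_iff_hasFDerivWithinAt_of_uniqueDiffOn (n := n) (f := h) hT).2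
      ⟨by simp, fun q ↦ (fderivWithin ℝ F S (h q)).inverse, ?_, hd⟩
    · exact_mod_cast this
    · intro q hq
      exact ContDiffAt.comp_contDiffWithinAt (f := fun q ↦ fderivWithin ℝ F S (h q)) q
        (hinv _ (hm hq)).contDiffAt_map_inverse
        (((hF'.of_le (by exact_mod_cast le_top)).comp ih hm) q hq)

/-- A `C^1` map on a convex set is strictly differentiable within this set. -/
theorem exists_approximatesLinearOn_ball {W : Type*} [NormedAddCommGroup W] [NormedSpace ℝ W]
    {F : V → W} {S N : Set V} {x : V} (hS : Convex ℝ S)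
    (hU : UniqueDiffOn ℝ S) (hN : IsOpen N) (hx : x ∈ N ∩ S) (hF : ContDiffOn ℝ 1 F (N ∩ S))
    {ε : ℝ} (hε : 0 < ε) :
    ∃ δ > 0, ∀ y ∈ Metric.ball x δ ∩ S, ∀ z ∈ Metric.ball x δ ∩ S,
      ‖F z - F y - fderivWithin ℝ F (N ∩ S) x (z - y)‖ ≤ ε * ‖z - y‖ := by
  have hU' : UniqueDiffOn ℝ (N ∩ S) := by rw [inter_comm]; exact hU.inter hN
  have hc : ContinuousOn (fderivWithin ℝ F (N ∩ S)) (N ∩ S) :=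
    hF.continuousOn_fderivWithin hU' le_rfl
  have h1 : ∀ᶠ y in 𝓝[N ∩ S] x, ‖fderivWithin ℝ F (N ∩ S) y - fderivWithin ℝ F (N ∩ S) x‖ ≤ ε := by
    have := (hc x hx).eventually (Metric.closedBall_mem_nhds _ hε)
    filter_upwards [this] with y hy
    simpa [dist_eq_norm] using hy
  obtain ⟨δ, hδ, hδ'⟩ := Metric.mem_nhdsWithin_iff.1 h1
  obtain ⟨δ₁, hδ₁, hδ₁'⟩ := Metric.isOpen_iff.1 hN x hx.1
  refine ⟨min δ δ₁, lt_min hδ hδ₁, fun y hy z hz ↦ ?_⟩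
  have hsub : Metric.ball x (min δ δ₁) ∩ S ⊆ N ∩ S := fun w hw ↦
    ⟨hδ₁' (Metric.ball_subset_ball (min_le_right _ _) hw.1), hw.2⟩
  refine Convex.norm_image_sub_le_of_norm_hasFDerivWithin_le' (s := Metric.ball x (min δ δ₁) ∩ S)
    (f' := fderivWithin ℝ F (N ∩ S)) (fun w hw ↦ ?_) (fun w hw ↦ ?_)
    ((convex_ball _ _).inter hS) hy hz
  · exact (hF.differentiableOn one_ne_zero w (hsub hw)).hasFDerivWithinAt.mono hsub
  · exact hδ' ⟨Metric.ball_subset_ball (min_le_left _ _) hw.1, hsub hw⟩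

end InverseFunction

/-! ### The inverse function theorem on a half-space -/

section HalfSpace

variable {V : Type*} [NormedAddCommGroup V] [NormedSpace ℝ V] {ℓ : V →L[ℝ] ℝ} {n : V}

theorem convex_halfSpace_nonneg (ℓ : V →L[ℝ] ℝ) : Convex ℝ {v | 0 ≤ ℓ v} :=
  convex_halfSpace_ge ℓ.toLinearMap.isLinear 0

theorem uniqueDiffOn_halfSpace_nonneg (hn : ℓ n = 1) : UniqueDiffOn ℝ {v | 0 ≤ ℓ v} := by
  refine uniqueDiffOn_convex (convex_halfSpace_nonneg ℓ) ⟨n, ?_⟩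
  refine mem_interior.2 ⟨{v | 0 < ℓ v}, fun v (hv : 0 < ℓ v) ↦ hv.le, ?_, by simp [hn]⟩
  exact isOpen_lt continuous_const ℓ.continuous

/-- The inverse function theorem at a boundary point of a half-space, for maps which fix the
boundary and preserve the half-space. -/
theorem exists_smooth_inverse_halfSpace [FiniteDimensional ℝ V] (hn : ℓ n = 1) {v₀ : V}
    (hv₀ : ℓ v₀ = 0) {F : V → V} {N : Set V} (hN : IsOpen N) (hv₀N : v₀ ∈ N)
    (hF : ContDiffOn ℝ ∞ F (N ∩ {v | 0 ≤ ℓ v})) (hfix : ∀ v ∈ N, ℓ v = 0 → F v = v) {c : ℝ}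
    (hc : 0 < c) (hpos : ∀ v ∈ N, 0 ≤ ℓ v → c * ℓ v ≤ ℓ (F v)) :
    ∃ (h : V → V) (P Q : Set V), IsOpen P ∧ v₀ ∈ P ∧ IsOpen Q ∧ P ⊆ N ∧
      MapsTo F (P ∩ {v | 0 ≤ ℓ v}) Q ∧ MapsTo h (Q ∩ {v | 0 ≤ ℓ v}) (P ∩ {v | 0 ≤ ℓ v}) ∧
      LeftInvOn h F (P ∩ {v | 0 ≤ ℓ v}) ∧ RightInvOn h F (Q ∩ {v | 0 ≤ ℓ v}) ∧
      ContDiffOn ℝ ∞ h (Q ∩ {v | 0 ≤ ℓ v}) := by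
  have : CompleteSpace V := FiniteDimensional.complete ℝ V
  set S : Set V := {v | 0 ≤ ℓ v} with hSdef
  have hSc : Convex ℝ S := convex_halfSpace_nonneg ℓ
  have hSu : UniqueDiffOn ℝ S := uniqueDiffOn_halfSpace_nonneg hn
  have hSu' : ∀ {O : Set V}, IsOpen O → UniqueDiffOn ℝ (O ∩ S) := fun hO ↦ by
    rw [inter_comm]; exact hSu.inter hO
  have hv₀S : v₀ ∈ S := by simp [hSdef, hv₀]
  set A : V →L[ℝ] V := fderivWithin ℝ F (N ∩ S) v₀ with hA
  have hFA : HasFDerivWithinAt F A S v₀ := by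
    have := (hF.differentiableOn (by simp) v₀ ⟨hv₀N, hv₀S⟩).hasFDerivWithinAt
    rw [inter_comm] at this
    rw [hA, inter_comm]
    exact this.mono_of_mem_nhdsWithin (inter_mem_nhdsWithin _ (hN.mem_nhds hv₀N))
  -- `ℓ ∘ F - c • ℓ` is nonnegative on the half-space near `v₀` and zero at `v₀`, so its derivative
  -- in the inward direction `n` is nonnegative. Since `A` is the identity on `ker ℓ`, this makes
  -- `A` injective.
  have hAn : c ≤ ℓ (A n) := by
    have h1 : HasFDerivWithinAt (fun v ↦ ℓ (F v) - c * ℓ v) (ℓ.comp A - c • ℓ) S v₀ := by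
      refine (ℓ.hasFDerivAt.comp_hasFDerivWithinAt v₀ hFA).sub ?_
      exact (ℓ.hasFDerivAt.hasFDerivWithinAt).const_mul c
    have h2 : IsLocalMinOn (fun v ↦ ℓ (F v) - c * ℓ v) S v₀ := by
      filter_upwards [self_mem_nhdsWithin, mem_nhdsWithin_of_mem_nhds (hN.mem_nhds hv₀N)]
        with v hv hvN
      have := hpos v hvN hv
      simp only [hfix v₀ hv₀N hv₀, hv₀]
      linarith
    have h3 := h2.hasFDerivWithinAt_nonneg h1 (y := n)
      (mem_posTangentConeAt_of_segment_subset (hSc.segment_subset hv₀S (by simp [hSdef, hv₀, hn])))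
    simp [hn] at h3
    linarith
  have hAker : ∀ w, ℓ w = 0 → A w = w := by
    intro w hw
    have hline : HasDerivAt (fun t : ℝ ↦ v₀ + t • w) w 0 := by
      simpa using ((hasDerivAt_id (0 : ℝ)).smul_const w).const_add v₀
    have h1 : HasDerivAt (F ∘ fun t : ℝ ↦ v₀ + t • w) (A w) 0 := by
      refine HasFDerivWithinAt.comp_hasDerivAt (t := S) (0 : ℝ) (by simpa using hFA) hline ?_
      exact Eventually.of_forall fun t ↦ by simp [hSdef, hv₀, hw]
    refine h1.unique (hline.congr_of_eventuallyEq ?_)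
    have : ∀ᶠ t : ℝ in 𝓝 0, v₀ + t • w ∈ N :=
      hline.continuousAt.preimage_mem_nhds (by simpa using hN.mem_nhds hv₀N)
    filter_upwards [this] with t ht
    exact hfix _ ht (by simp [hv₀, hw])
  have hdec : ∀ w, ℓ (A w) = ℓ w * ℓ (A n) := by
    intro w
    have : A w = A (w - ℓ w • n) + ℓ w • A n := by simp
    rw [this, hAker (w - ℓ w • n) (by simp [hn])]
    simp [hn]
  have hAinj : Function.Injective A := by
    rw [injective_iff_map_eq_zero]
    intro w hw
    have h1 := hdec w
    rw [hw, map_zero] at h1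
    have : ℓ w = 0 := by
      rcases mul_eq_zero.1 h1.symm with h | h
      · exact h
      · linarith
    rw [← hAker w this, hw]
  let A' : V ≃L[ℝ] V := (LinearEquiv.ofInjectiveEndo A.toLinearMap hAinj).toContinuousLinearEquiv
  have hA' : (A' : V →L[ℝ] V) = A := by ext; rfl
  -- the retraction onto the half-space and the extension of `F`
  let π : V → V := fun v ↦ v + max (-ℓ v) 0 • n
  have hπS : ∀ v, π v ∈ S := fun v ↦ by
    simp only [π, hSdef, mem_ofPred_eq, map_add, map_smul, hn, smul_eq_mul, mul_one]
    linarith [le_max_left (-ℓ v) 0]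
  have hπid : ∀ v ∈ S, π v = v := fun v hv ↦ by
    simp only [hSdef, mem_ofPred_eq] at hv
    simp [π, hv]
  have hπc : Continuous π := by fun_prop
  let K : ℝ := 1 + ‖ℓ‖ * ‖n‖
  have hK : 0 < K := by positivity
  have hπlip : ∀ v w, ‖π v - π w‖ ≤ K * ‖v - w‖ := by
    intro v w
    have h1 : π v - π w = (v - w) + (max (-ℓ v) 0 - max (-ℓ w) 0) • n := by
      simp only [π, sub_smul]; abel
    have h2 : |max (-ℓ v) 0 - max (-ℓ w) 0| ≤ ‖ℓ‖ * ‖v - w‖ := by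
      refine (abs_max_sub_max_le_abs _ _ _).trans ?_
      rw [← abs_neg, show -(-ℓ v - -ℓ w) = ℓ (v - w) by simp; ring]
      exact ℓ.le_opNorm _
    rw [h1]
    calc _ ≤ ‖v - w‖ + ‖(max (-ℓ v) 0 - max (-ℓ w) 0) • n‖ := norm_add_le _ _
      _ ≤ ‖v - w‖ + ‖ℓ‖ * ‖v - w‖ * ‖n‖ := by
        rw [norm_smul, Real.norm_eq_abs]; gcongr
      _ = K * ‖v - w‖ := by simp only [K]; ring
  -- Only the nonlinear remainder of `F` is composed with `π`. The map `F ∘ π` need not be strictly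
  -- differentiable at `v₀`, because `π` has a kink; the remainder has arbitrarily small Lipschitz
  -- constant near `v₀`, and the Lipschitz map `π` preserves this.
  let G : V → V := fun v ↦ A v + (F (π v) - A (π v))
  have hGS : ∀ v ∈ S, G v = F v := fun v hv ↦ by simp [G, hπid v hv]
  have hG : HasStrictFDerivAt G (A' : V →L[ℝ] V) v₀ := by
    rw [hA']
    refine .of_isLittleO (Asymptotics.isLittleO_iff.2 fun ε hε ↦ ?_)
    obtain ⟨δ, hδ, H⟩ := exists_approximatesLinearOn_ball hSc hSu hN ⟨hv₀N, hv₀S⟩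
      (hF.of_le (by exact_mod_cast le_top)) (div_pos hε hK)
    have hb : ∀ᶠ v in 𝓝 v₀, π v ∈ Metric.ball v₀ δ :=
      hπc.continuousAt.preimage_mem_nhds (by rw [hπid v₀ hv₀S]; exact Metric.ball_mem_nhds _ hδ)
    rw [nhds_prod_eq]
    filter_upwards [hb.prod_mk hb] with q hq
    have h1 := H _ ⟨hq.2, hπS _⟩ _ ⟨hq.1, hπS _⟩
    have h2 : G q.1 - G q.2 - A (q.1 - q.2) =
        F (π q.1) - F (π q.2) - A (π q.1 - π q.2) := by
      simp only [G, map_sub]; abel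
    rw [h2]
    calc _ ≤ ε / K * ‖π q.1 - π q.2‖ := h1
      _ ≤ ε / K * (K * ‖q.1 - q.2‖) := by gcongr; exact hπlip _ _
      _ = ε * ‖q.1 - q.2‖ := by field_simp
  let e := hG.toOpenPartialHomeomorph G
  have he : ∀ v, e v = G v := fun v ↦ rfl
  -- the domain where the derivative is invertible
  have hF'c : ContinuousOn (fderivWithin ℝ F (N ∩ S)) (N ∩ S) :=
    hF.continuousOn_fderivWithin (hSu' hN) (by simp)
  obtain ⟨O, hO, hOv, hOinv⟩ : ∃ O, IsOpen O ∧ v₀ ∈ O ∧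
      ∀ v ∈ O ∩ (N ∩ S), (fderivWithin ℝ F (N ∩ S) v).IsInvertible := by
    have h1 : ∀ᶠ B in 𝓝 A, ContinuousLinearMap.IsInvertible B := by
      rw [← hA']
      exact (ContinuousLinearEquiv.nhds A')
    exact mem_nhdsWithin.1 ((hF'c v₀ ⟨hv₀N, hv₀S⟩).eventually h1)
  let P : Set V := e.source ∩ (N ∩ O ∩ π ⁻¹' N)
  have hPo : IsOpen P := e.open_source.inter ((hN.inter hO).inter (hN.preimage hπc))
  have hPN : P ⊆ N := fun v hv ↦ hv.2.1.1
  let Q : Set V := e '' P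
  have hQo : IsOpen Q := e.isOpen_image_of_subset_source hPo inter_subset_left
  -- If `ℓ v < 0`, then `π v` lies on the boundary and is fixed by `F`, so `ℓ (G v) = ℓ v * ℓ (A n)
  -- < 0`. Thus `G` sends no outside point of `P` into the half-space.
  have hback : MapsTo e.symm (Q ∩ S) (P ∩ S) := by
    rintro _ ⟨⟨v, hv, rfl⟩, hq⟩
    rw [e.left_inv hv.1]
    refine ⟨hv, ?_⟩
    by_contra hneg
    have hneg' : ℓ v < 0 := by simpa [hSdef] using hneg
    have hmax : max (-ℓ v) 0 = -ℓ v := max_eq_left (by linarith)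
    have h0 : ℓ (π v) = 0 := by simp [π, hmax, hn]
    have h1 : ℓ (e v) = ℓ v * ℓ (A n) := by
      simp only [he, G]
      rw [map_add, map_sub, hfix (π v) hv.2.2 h0, hdec, hdec (π v), h0]
      ring
    have h2 : 0 ≤ ℓ (e v) := hq
    nlinarith
  have hPS : P ∩ S ⊆ N ∩ S := fun v hv ↦ ⟨hPN hv.1, hv.2⟩
  refine ⟨e.symm, P, Q, hPo, ⟨hG.mem_toOpenPartialHomeomorph_source, ⟨hv₀N, hOv⟩,
    by simpa [hπid v₀ hv₀S] using hv₀N⟩, hQo, hPN, ?_, hback, ?_, ?_, ?_⟩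
  · intro v hv
    exact ⟨v, hv.1, by rw [he, hGS v hv.2]⟩
  · intro v hv
    rw [← hGS v hv.2, ← he, e.left_inv hv.1.1]
  · intro q hq
    rw [← hGS _ (hback hq).2, ← he, e.right_inv]
    obtain ⟨v, hv, rfl⟩ := hq.1
    exact e.map_source hv.1
  · have hQt : Q ⊆ e.target := by
      rintro _ ⟨v, hv, rfl⟩
      exact e.map_source hv.1
    refine contDiffOn_infty_of_rightInverse (hF.mono hPS) (hSu' hPo) (hSu' hQo)
      (e.continuousOn_symm.mono fun q hq ↦ hQt hq.1) hback (fun q hq ↦ ?_) (fun v hv ↦ ?_)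
    · rw [← hGS _ (hback hq).2, ← he, e.right_inv (hQt hq.1)]
    · have : fderivWithin ℝ F (P ∩ S) v = fderivWithin ℝ F (N ∩ S) v := by
        have h1 : P ∩ S = (N ∩ S) ∩ P := by
          ext w; exact ⟨fun hw ↦ ⟨hPS hw, hw.1⟩, fun hw ↦ ⟨hw.2, hw.1.2⟩⟩
        rw [h1, fderivWithin_inter (hPo.mem_nhds hv.1)]
      rw [this]
      exact hOinv v ⟨hv.1.2.1.2, hPS hv⟩

end HalfSpace

/-! ### The boundary coordinate in different charts -/

section BoundaryCoordinate

variable {V H M : Type*} [NormedAddCommGroup V] [NormedSpace ℝ V] [TopologicalSpace H]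
  {I : ModelWithCorners ℝ V H} [TopologicalSpace M] [ChartedSpace H M]
  {ℓ : V →L[ℝ] ℝ} {n : V}

theorem interior_halfSpace_nonneg (hn : ℓ n = 1) : interior {v | 0 ≤ ℓ v} = {v | 0 < ℓ v} := by
  refine subset_antisymm (fun v hv ↦ ?_)
    (interior_maximal (fun v (hv : 0 < ℓ v) ↦ hv.le) (isOpen_lt continuous_const ℓ.continuous))
  have h1 : ∀ᶠ t : ℝ in 𝓝 0, v + t • n ∈ {v | 0 ≤ ℓ v} := by
    have hc : Continuous fun t : ℝ ↦ v + t • n := by fun_prop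
    exact hc.continuousAt.preimage_mem_nhds (by simpa using mem_interior_iff_mem_nhds.1 hv)
  obtain ⟨t, ht, ht'⟩ := (h1.filter_mono nhdsWithin_le_nhds |>.and
    (self_mem_nhdsWithin : Iio (0 : ℝ) ∈ 𝓝[<] 0)).exists
  simp only [mem_ofPred_eq, map_add, map_smul, hn, smul_eq_mul, mul_one] at ht ⊢
  have : t < 0 := ht'
  linarith

theorem extChartAt_mem_halfSpace (hI : range I = {v | 0 ≤ ℓ v}) (x₀ x : M) :
    0 ≤ ℓ (extChartAt I x₀ x) := by
  have : extChartAt I x₀ x ∈ range I := by simp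
  rwa [hI] at this

/-- The boundary is given by the vanishing of the boundary coordinate, in every chart. -/
theorem mem_boundary_iff_extChartAt_eq_zero [IsManifold I ∞ M] (hI : range I = {v | 0 ≤ ℓ v})
    (hn : ℓ n = 1) {x₀ x : M} (hx : x ∈ (extChartAt I x₀).source) :
    x ∈ I.boundary M ↔ ℓ (extChartAt I x₀ x) = 0 := by
  rw [extChartAt_source] at hx
  have h1 : I.IsInteriorPoint x ↔ 0 < ℓ (extChartAt I x₀ x) := by
    rw [I.isInteriorPoint_iff_of_mem_atlas (n := ∞) (by simp) (chart_mem_atlas H x₀) hx]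
    constructor
    · intro h
      have := interior_mono ((chartAt H x₀).extend_target_subset_range (I := I)) h
      rw [hI, interior_halfSpace_nonneg hn] at this
      exact this
    · intro h
      refine (chartAt H x₀).mem_interior_extend_target ((chartAt H x₀).map_source hx) ?_
      rw [hI, interior_halfSpace_nonneg hn]
      exact h
  have h2 := extChartAt_mem_halfSpace hI x₀ x
  change I.IsBoundaryPoint x ↔ _
  rw [I.isBoundaryPoint_iff_not_isInteriorPoint, h1, not_lt]
  exact ⟨fun h ↦ le_antisymm h h2, fun h ↦ h.le⟩

/-- The boundary coordinates of two charts are comparable near the boundary. -/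
theorem exists_mul_boundaryCoordinate_le [IsManifold I ∞ M] (hI : range I = {v | 0 ≤ ℓ v})
    (hn : ℓ n = 1) {x₀ x : M} (hx : x ∈ (extChartAt I x₀).source) (hxb : x ∈ I.boundary M) :
    ∃ c > 0, ∀ᶠ y in 𝓝 x, c * ℓ (extChartAt I x y) ≤ ℓ (extChartAt I x₀ y) := by
  have h0 : ℓ (extChartAt I x₀ x) = 0 := (mem_boundary_iff_extChartAt_eq_zero hI hn hx).1 hxb
  have hτ : ContDiffWithinAt ℝ 1 (extChartAt I x ∘ (extChartAt I x₀).symm) (range I)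
      (extChartAt I x₀ x) := by
    refine contDiffWithinAt_ext_coord_change (n := 1) x x₀ ?_
    rw [PartialEquiv.trans_source, PartialEquiv.symm_source]
    exact ⟨(extChartAt I x₀).map_source hx, by
      rw [mem_preimage, (extChartAt I x₀).left_inv hx]; exact mem_extChartAt_source x⟩
  obtain ⟨K, t, ht, hK⟩ := hτ.exists_lipschitzOnWith I.convex_range
  have ht' : ∀ᶠ v in 𝓝[range I] (extChartAt I x₀ x), v ∈ t ∧ v ∈ (extChartAt I x₀).target ∧
      (extChartAt I x₀).symm v ∈ (extChartAt I x).source := by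
    refine Eventually.and ht (Eventually.and (extChartAt_target_mem_nhdsWithin' hx) ?_)
    refine ((continuousAt_extChartAt_symm' hx).eventually_mem ?_).filter_mono nhdsWithin_le_nhds
    rw [(extChartAt I x₀).left_inv hx]
    exact extChartAt_source_mem_nhds x
  -- Projection to the boundary along `n`. The chart change is Lipschitz and sends `π v` to a
  -- boundary point, so the new boundary coordinate is at most a constant times `‖v - π v‖ = ℓ v *
  -- ‖n‖`.
  let π : V → V := fun v ↦ v - ℓ v • n
  have hπ : Tendsto π (𝓝[range I] (extChartAt I x₀ x)) (𝓝[range I] (extChartAt I x₀ x)) := by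
    have hc : Continuous π := by fun_prop
    refine tendsto_nhdsWithin_of_tendsto_nhds_of_eventually_within _ ?_ (.of_forall fun v ↦ ?_)
    · have := hc.tendsto (extChartAt I x₀ x)
      simp only [π, h0, zero_smul, sub_zero] at this
      exact this.mono_left nhdsWithin_le_nhds
    · simp [hI, π, hn]
  have hy := (ht'.and (hπ.eventually ht'))
  rw [← map_extChartAt_nhds' hx, eventually_map] at hy
  have hC : 0 < ‖ℓ‖ * (K * ‖n‖) + 1 := by positivity
  refine ⟨(‖ℓ‖ * (K * ‖n‖) + 1)⁻¹, by positivity, ?_⟩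
  filter_upwards [hy, extChartAt_source_mem_nhds' hx] with y ⟨h1, h2⟩ hys
  set v := extChartAt I x₀ y with hv
  have hv0 : 0 ≤ ℓ v := extChartAt_mem_halfSpace hI x₀ y
  have h3 := hK.norm_sub_le h1.1 h2.1
  have h4 : (extChartAt I x₀).symm (π v) ∈ I.boundary M := by
    rw [mem_boundary_iff_extChartAt_eq_zero hI hn ((extChartAt I x₀).map_target h2.2.1),
      (extChartAt I x₀).right_inv h2.2.1]
    simp [π, hn]
  rw [mem_boundary_iff_extChartAt_eq_zero hI hn h2.2.2] at h4
  simp only [Function.comp_apply] at h3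
  rw [hv, (extChartAt I x₀).left_inv hys, ← hv] at h3
  have h5 : ℓ (extChartAt I x y) ≤ ‖ℓ‖ * (K * ‖n‖) * ℓ v := by
    calc ℓ (extChartAt I x y)
        = ℓ (extChartAt I x y - extChartAt I x ((extChartAt I x₀).symm (π v))) := by
          rw [map_sub, h4, sub_zero]
      _ ≤ ‖ℓ‖ * ‖extChartAt I x y - extChartAt I x ((extChartAt I x₀).symm (π v))‖ :=
          (le_abs_self _).trans (ℓ.le_opNorm _)
      _ ≤ ‖ℓ‖ * (K * ‖v - π v‖) := by gcongr
      _ = ‖ℓ‖ * (K * ‖n‖) * ℓ v := by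
          simp only [π, sub_sub_cancel, norm_smul, Real.norm_eq_abs, abs_of_nonneg hv0]; ring
  rw [inv_mul_le_iff₀ hC]
  linarith

end BoundaryCoordinate

/-! ### Boundary retraction and boundary defining function -/

section Retraction

variable {V H M : Type*} [NormedAddCommGroup V] [NormedSpace ℝ V] [FiniteDimensional ℝ V]
  [TopologicalSpace H] {I : ModelWithCorners ℝ V H} [TopologicalSpace M] [ChartedSpace H M]
  [IsManifold I ∞ M] [T2Space M] {ℓ : V →L[ℝ] ℝ} {n : V}

/-- Near a boundary point, the manifold can be pushed into its boundary, fixing the boundary. -/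
theorem exists_local_boundary_retraction (hI : range I = {v | 0 ≤ ℓ v}) (hn : ℓ n = 1) {x₀ : M}
    (hx₀ : x₀ ∈ I.boundary M) :
    ∃ r : M → M, ContMDiff I I ∞ r ∧ (∀ x ∈ I.boundary M, r x = x) ∧
      ∀ᶠ x in 𝓝 x₀, r x ∈ I.boundary M := by
  classical
  set φ := extChartAt I x₀ with hφ
  obtain ⟨δ, hδ, hδt⟩ := Metric.mem_nhdsWithin_iff.1 (extChartAt_target_mem_nhdsWithin (I := I) x₀)
  have hℓ0 : ℓ (φ x₀) = 0 :=
    (mem_boundary_iff_extChartAt_eq_zero hI hn (mem_extChartAt_source x₀)).1 hx₀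
  -- Sliding a point of the chart towards the boundary along `n` increases its distance from `φ x₀`
  -- at most by the factor `C`, so points within `δ / C` stay in the chart.
  let C : ℝ := 1 + ‖ℓ‖ * ‖n‖
  have hC : 0 < C := by positivity
  let U : Set M := φ.source ∩ φ ⁻¹' Metric.ball (φ x₀) (δ / C)
  have hUo : IsOpen U := by
    simpa only [U, hφ, extChartAt_source] using isOpen_extChartAt_preimage x₀ Metric.isOpen_ball
  have hUx : x₀ ∈ U := ⟨mem_extChartAt_source x₀, Metric.mem_ball_self (by positivity)⟩
  have hUt : ∀ x ∈ U, ∀ a ∈ Icc (0 : ℝ) 1, φ x - (a * ℓ (φ x)) • n ∈ φ.target := by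
    intro x hx a ha
    have h0 : 0 ≤ ℓ (φ x) := extChartAt_mem_halfSpace hI x₀ x
    refine hδt ⟨?_, ?_⟩
    · have h1 : ‖φ x - φ x₀‖ < δ / C := by simpa [dist_eq_norm] using hx.2
      have h2 : ℓ (φ x) ≤ ‖ℓ‖ * ‖φ x - φ x₀‖ := by
        have : ℓ (φ x) = ℓ (φ x - φ x₀) := by rw [map_sub, hℓ0, sub_zero]
        rw [this]
        exact (le_abs_self _).trans (ℓ.le_opNorm _)
      have h3 : a * ℓ (φ x) ≤ ℓ (φ x) := mul_le_of_le_one_left h0 ha.2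
      rw [Metric.mem_ball, dist_eq_norm]
      calc ‖φ x - (a * ℓ (φ x)) • n - φ x₀‖ = ‖(φ x - φ x₀) - (a * ℓ (φ x)) • n‖ := by
            congr 1; abel
        _ ≤ ‖φ x - φ x₀‖ + ‖(a * ℓ (φ x)) • n‖ := norm_sub_le _ _
        _ = ‖φ x - φ x₀‖ + (a * ℓ (φ x)) * ‖n‖ := by
            rw [norm_smul, Real.norm_eq_abs, abs_of_nonneg (mul_nonneg ha.1 h0)]
        _ ≤ ‖φ x - φ x₀‖ + (‖ℓ‖ * ‖φ x - φ x₀‖) * ‖n‖ := by gcongr _ + ?_ * ‖n‖; exact h3.trans h2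
        _ = C * ‖φ x - φ x₀‖ := by simp only [C]; ring
        _ < C * (δ / C) := by gcongr
        _ = δ := by field_simp
    · have h3 : a * ℓ (φ x) ≤ ℓ (φ x) := mul_le_of_le_one_left h0 ha.2
      simp only [hI, mem_ofPred_eq, map_sub, map_smul, hn, smul_eq_mul, mul_one]
      linarith
  obtain ⟨ψ, -, hψ⟩ := (SmoothBumpFunction.nhds_basis_tsupport (I := I) x₀).mem_iff.1
    (hUo.mem_nhds hUx)
  -- The bump function controls how far points slide: all the way to the boundary where `ψ = 1`, not
  -- at all where `ψ = 0`.
  let r : M → M := fun x ↦ if x ∈ U then φ.symm (φ x - (ψ x * ℓ (φ x)) • n) else x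
  have hrU : ∀ x ∈ U, r x = φ.symm (φ x - (ψ x * ℓ (φ x)) • n) := fun x hx ↦ if_pos hx
  have hφU : ContMDiffOn I 𝓘(ℝ, V) ∞ φ U := contMDiffOn_extChartAt.mono fun x hx ↦ by
    simpa only [hφ, extChartAt_source] using hx.1
  refine ⟨r, fun x ↦ ?_, fun x hx ↦ ?_, ?_⟩
  · by_cases hx : x ∈ tsupport ψ
    · have h1 : ContMDiffOn I 𝓘(ℝ, V) ∞ (fun x ↦ φ x - (ψ x * ℓ (φ x)) • n) U := by
        have h2 : ContMDiffOn I 𝓘(ℝ, ℝ) ∞ (fun x ↦ ψ x * ℓ (φ x)) U :=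
          ψ.contMDiff.contMDiffOn.mul (ℓ.contMDiff.comp_contMDiffOn hφU)
        exact hφU.sub (h2.smul (contMDiffOn_const (c := n)))
      have h2 : ContMDiffOn I I ∞ (fun x ↦ φ.symm (φ x - (ψ x * ℓ (φ x)) • n)) U :=
        (contMDiffOn_extChartAt_symm x₀).comp h1 fun x hx ↦ hUt x hx _ ψ.mem_Icc
      exact ((h2.congr hrU).contMDiffAt (hUo.mem_nhds (hψ hx)))
    · refine contMDiffAt_id.congr_of_eventuallyEq ?_
      filter_upwards [(isClosed_tsupport ψ).isOpen_compl.mem_nhds hx] with y hy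
      by_cases hyU : y ∈ U
      · rw [hrU y hyU, image_eq_zero_of_notMem_tsupport hy]
        simp [φ.left_inv hyU.1]
      · exact if_neg hyU
  · by_cases hxU : x ∈ U
    · rw [hrU x hxU, (mem_boundary_iff_extChartAt_eq_zero hI hn hxU.1).1 hx]
      simp [φ.left_inv hxU.1]
    · exact if_neg hxU
  · filter_upwards [hUo.mem_nhds hUx, ψ.eventuallyEq_one] with x hx hψ1
    have h1 := hUt x hx 1 (by simp)
    have h2 : r x = φ.symm (φ x - (1 * ℓ (φ x)) • n) := by rw [hrU x hx, hψ1]; rfl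
    rw [h2, mem_boundary_iff_extChartAt_eq_zero hI hn (φ.map_target h1), φ.right_inv h1]
    simp [hn]

/-- Local retractions compose: a later factor fixes points already pushed into the boundary, and an
earlier factor is continuous and fixes boundary points, so it keeps nearby points where the later
one works. -/
theorem exists_boundary_retraction [CompactSpace M] (hI : range I = {v | 0 ≤ ℓ v}) (hn : ℓ n = 1) :
    ∃ (r : M → M) (O : Set M), ContMDiff I I ∞ r ∧ (∀ x ∈ I.boundary M, r x = x) ∧
      IsOpen O ∧ I.boundary M ⊆ O ∧ MapsTo r O (I.boundary M) := by
  have hX : IsCompact (I.boundary M) := (I.isClosed_boundary (n := ∞) (by simp)).isCompact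
  suffices h : ∃ r : M → M, ContMDiff I I ∞ r ∧ (∀ x ∈ I.boundary M, r x = x) ∧
      ∀ x ∈ I.boundary M ∩ I.boundary M, ∀ᶠ y in 𝓝 x, r y ∈ I.boundary M by
    obtain ⟨r, h1, h2, h3⟩ := h
    rw [inter_self] at h3
    refine ⟨r, interior (r ⁻¹' I.boundary M), h1, h2, isOpen_interior, fun x hx ↦ ?_,
      fun x hx ↦ interior_subset (s := r ⁻¹' I.boundary M) hx⟩
    exact mem_interior_iff_mem_nhds.2 (h3 x hx)
  refine hX.induction_on (p := fun S ↦ ∃ r : M → M, ContMDiff I I ∞ r ∧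
    (∀ x ∈ I.boundary M, r x = x) ∧ ∀ x ∈ I.boundary M ∩ S, ∀ᶠ y in 𝓝 x, r y ∈ I.boundary M)
    ⟨id, contMDiff_id, by simp, by simp⟩ ?_ ?_ ?_
  · rintro S T hST ⟨r, h1, h2, h3⟩
    exact ⟨r, h1, h2, fun x hx ↦ h3 x ⟨hx.1, hST hx.2⟩⟩
  · rintro S T ⟨r, h1, h2, h3⟩ ⟨r', h1', h2', h3'⟩
    refine ⟨r' ∘ r, h1'.comp h1, fun x hx ↦ by simp [h2 x hx, h2' x hx], ?_⟩
    rintro x ⟨hx, hxS | hxT⟩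
    · filter_upwards [h3 x ⟨hx, hxS⟩] with y hy
      simpa [h2' _ hy] using hy
    · have := h3' x ⟨hx, hxT⟩
      rw [← h2 x hx] at this
      exact h1.continuous.continuousAt.eventually this
  · intro x hx
    obtain ⟨r, h1, h2, h3⟩ := exists_local_boundary_retraction hI hn hx
    exact ⟨_, mem_nhdsWithin_of_mem_nhds h3.eventually_nhds, r, h1, h2, fun y hy ↦ hy.2⟩

/-- A smooth function which defines the boundary. -/
theorem exists_boundary_definingFunction [CompactSpace M] (hI : range I = {v | 0 ≤ ℓ v})
    (hn : ℓ n = 1) :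
    ∃ s : M → ℝ, ContMDiff I 𝓘(ℝ, ℝ) ∞ s ∧ (∀ x, 0 ≤ s x) ∧ (∀ x ∈ I.boundary M, s x = 0) ∧
      ∀ x ∈ I.boundary M, ∃ c > 0, ∀ᶠ y in 𝓝 x, c * ℓ (extChartAt I x y) ≤ s y := by
  have hX : IsCompact (I.boundary M) := (I.isClosed_boundary (n := ∞) (by simp)).isCompact
  suffices h : ∃ s : M → ℝ, ContMDiff I 𝓘(ℝ, ℝ) ∞ s ∧ (∀ x, 0 ≤ s x) ∧
      (∀ x ∈ I.boundary M, s x = 0) ∧ ∀ x ∈ I.boundary M ∩ I.boundary M,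
      ∃ c > 0, ∀ᶠ y in 𝓝 x, c * ℓ (extChartAt I x y) ≤ s y by
    simpa only [inter_self] using h
  refine hX.induction_on (p := fun S ↦ ∃ s : M → ℝ, ContMDiff I 𝓘(ℝ, ℝ) ∞ s ∧ (∀ x, 0 ≤ s x) ∧
      (∀ x ∈ I.boundary M, s x = 0) ∧ ∀ x ∈ I.boundary M ∩ S,
      ∃ c > 0, ∀ᶠ y in 𝓝 x, c * ℓ (extChartAt I x y) ≤ s y)
    ⟨fun _ ↦ 0, contMDiff_const, by simp, by simp, by simp⟩ ?_ ?_ ?_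
  · rintro S T hST ⟨s, h1, h2, h3, h4⟩
    exact ⟨s, h1, h2, h3, fun x hx ↦ h4 x ⟨hx.1, hST hx.2⟩⟩
  · rintro S T ⟨s, h1, h2, h3, h4⟩ ⟨s', h1', h2', h3', h4'⟩
    refine ⟨fun x ↦ s x + s' x, h1.add h1', fun x ↦ add_nonneg (h2 x) (h2' x),
      fun x hx ↦ by simp [h3 x hx, h3' x hx], ?_⟩
    rintro x ⟨hx, hxS | hxT⟩
    · obtain ⟨c, hc, h⟩ := h4 x ⟨hx, hxS⟩
      refine ⟨c, hc, h.mono fun y hy ↦ ?_⟩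
      linarith [h2' y]
    · obtain ⟨c, hc, h⟩ := h4' x ⟨hx, hxT⟩
      refine ⟨c, hc, h.mono fun y hy ↦ ?_⟩
      linarith [h2 y]
  -- The local function is a bump function times the boundary coordinate at `x₀`. The required bound
  -- at `x` refers to the chart at `x`, whence the comparison of the two coordinates. Nonnegativity
  -- preserves such bounds under sums.
  · intro x₀ hx₀
    obtain ⟨ψ⟩ : Nonempty (SmoothBumpFunction I x₀) := inferInstance
    refine ⟨{x | ψ =ᶠ[𝓝 x] 1} ∩ (extChartAt I x₀).source, mem_nhdsWithin_of_mem_nhds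
      (inter_mem ψ.eventuallyEq_one.eventually_nhds (extChartAt_source_mem_nhds x₀)),
      fun x ↦ ψ x • ℓ (extChartAt I x₀ x), ψ.contMDiff_smul
      (ℓ.contMDiff.comp_contMDiffOn contMDiffOn_extChartAt),
      fun x ↦ mul_nonneg ψ.nonneg (extChartAt_mem_halfSpace hI x₀ x), fun x hx ↦ ?_, ?_⟩
    · by_cases h : x ∈ (extChartAt I x₀).source
      · simp only [(mem_boundary_iff_extChartAt_eq_zero hI hn h).1 hx, smul_zero]
      · have : x ∉ Function.support ψ := fun h' ↦
          h (by rw [extChartAt_source]; exact ψ.support_subset_source h')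
        simp [Function.notMem_support.1 this]
    · rintro x ⟨hx, hψ, hxs⟩
      obtain ⟨c, hc, h⟩ := exists_mul_boundaryCoordinate_le hI hn hxs hx
      refine ⟨c, hc, ?_⟩
      filter_upwards [h, hψ] with y hy hy1
      simpa [hy1] using hy

end Retraction

/-! ### Existence of collars on compact manifolds -/

section CollarExistence

variable {V H M : Type*} [NormedAddCommGroup V] [NormedSpace ℝ V] [FiniteDimensional ℝ V]
  [TopologicalSpace H] {I : ModelWithCorners ℝ V H} [TopologicalSpace M] [ChartedSpace H M]
  [IsManifold I ∞ M] {ℓ : V →L[ℝ] ℝ} {n : V}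

/-- A retraction onto the boundary and a boundary defining function together are a local
diffeomorphism onto `∂M × [0, ∞)` at each boundary point. -/
theorem exists_local_inverse_retraction_prod (hI : range I = {v | 0 ≤ ℓ v}) (hn : ℓ n = 1)
    {r : M → M} {O : Set M} (hr : ContMDiff I I ∞ r) (hrfix : ∀ x ∈ I.boundary M, r x = x)
    (hO : IsOpen O) (hXO : I.boundary M ⊆ O) (hrO : MapsTo r O (I.boundary M))
    {s : M → ℝ} (hs : ContMDiff I 𝓘(ℝ, ℝ) ∞ s)
    (hs0 : ∀ x ∈ I.boundary M, s x = 0) {x₀ : M} (hx₀ : x₀ ∈ I.boundary M)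
    (hsc : ∃ c > 0, ∀ᶠ y in 𝓝 x₀, c * ℓ (extChartAt I x₀ y) ≤ s y) :
    ∃ (h : M × ℝ → M) (P : Set M) (Q : Set (M × ℝ)), IsOpen P ∧ x₀ ∈ P ∧ IsOpen Q ∧ P ⊆ O ∧
      (∀ w ∈ P, (r w, s w) ∈ Q) ∧ (∀ w ∈ P, h (r w, s w) = w) ∧
      (∀ q ∈ Q ∩ I.boundary M ×ˢ Ici 0, h q ∈ P ∧ (r (h q), s (h q)) = q) ∧
      ContMDiffOn (I.prod 𝓘(ℝ, ℝ)) I ∞ h (Q ∩ I.boundary M ×ˢ Ici 0) := by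
  obtain ⟨c, hc, hsc⟩ := hsc
  set φ := extChartAt I x₀ with hφ
  have hbd : ∀ {x}, x ∈ φ.source → (x ∈ I.boundary M ↔ ℓ (φ x) = 0) := fun hx ↦
    mem_boundary_iff_extChartAt_eq_zero hI hn hx
  have hφ0 : ∀ x, 0 ≤ ℓ (φ x) := extChartAt_mem_halfSpace hI x₀
  have hφs : ContMDiffOn I 𝓘(ℝ, V) ∞ φ φ.source := by
    simpa only [hφ, extChartAt_source] using contMDiffOn_extChartAt (I := I) (n := ∞) (x := x₀)
  have hgood : ∀ᶠ w in 𝓝 x₀, w ∈ O ∧ r w ∈ φ.source ∧ c * ℓ (φ w) ≤ s w := by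
    refine Filter.Eventually.and (hO.mem_nhds (hXO hx₀)) (Filter.Eventually.and ?_ hsc)
    refine hr.continuous.continuousAt.eventually_mem ?_
    rw [hrfix x₀ hx₀]
    exact extChartAt_source_mem_nhds x₀
  obtain ⟨N, hN, hvN, hNT⟩ : ∃ N, IsOpen N ∧ φ x₀ ∈ N ∧ ∀ v ∈ N ∩ {v | 0 ≤ ℓ v}, v ∈ φ.target ∧
      φ.symm v ∈ O ∧ r (φ.symm v) ∈ φ.source ∧ c * ℓ v ≤ s (φ.symm v) := by
    rw [← map_extChartAt_symm_nhdsWithin_range (I := I), eventually_map] at hgood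
    obtain ⟨N, hN, hv, h⟩ := mem_nhdsWithin.1 (Filter.Eventually.and
      (extChartAt_target_mem_nhdsWithin (I := I) x₀) hgood)
    refine ⟨N, hN, hv, fun v hvN ↦ ?_⟩
    rw [← hI] at hvN
    obtain ⟨h1, h2, h3, h4⟩ := h hvN
    refine ⟨h1, h2, h3, ?_⟩
    rwa [← hφ, φ.right_inv h1] at h4
  let F : V → V := fun v ↦ φ (r (φ.symm v)) + s (φ.symm v) • n
  have hFℓ : ∀ v ∈ N, 0 ≤ ℓ v → ℓ (F v) = s (φ.symm v) := by
    intro v hv hv0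
    obtain ⟨-, h2, h3, -⟩ := hNT v ⟨hv, hv0⟩
    simp [F, hn, (hbd h3).1 (hrO h2)]
  have hF : ContDiffOn ℝ ∞ F (N ∩ {v | 0 ≤ ℓ v}) := by
    rw [← contMDiffOn_iff_contDiffOn]
    have h1 : ContMDiffOn 𝓘(ℝ, V) I ∞ φ.symm (N ∩ {v | 0 ≤ ℓ v}) :=
      (contMDiffOn_extChartAt_symm x₀).mono fun v hv ↦ (hNT v hv).1
    exact (hφs.comp (hr.comp_contMDiffOn h1) fun v hv ↦ (hNT v hv).2.2.1).add
      ((hs.comp_contMDiffOn h1).smul contMDiffOn_const)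
  have hFfix : ∀ v ∈ N, ℓ v = 0 → F v = v := by
    intro v hv hv0
    have h1 := (hNT v ⟨hv, hv0.ge⟩).1
    have h2 : φ.symm v ∈ I.boundary M := by
      rw [hbd (φ.map_target h1), φ.right_inv h1, hv0]
    simp [F, hs0 _ h2, hrfix _ h2, φ.right_inv h1]
  have hFpos : ∀ v ∈ N, 0 ≤ ℓ v → c * ℓ v ≤ ℓ (F v) := by
    intro v hv hv0
    rw [hFℓ v hv hv0]
    exact (hNT v ⟨hv, hv0⟩).2.2.2
  obtain ⟨h, P, Q, hP, hvP, hQ, hPN, hFm, hhm, hl, hri, hhs⟩ := exists_smooth_inverse_halfSpace hn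
    ((hbd (mem_extChartAt_source x₀)).1 hx₀) hN hvN hF hFfix hc hFpos
  let k : M × ℝ → V := fun q ↦ φ q.1 + q.2 • n
  have hk : ContMDiffOn (I.prod 𝓘(ℝ, ℝ)) 𝓘(ℝ, V) ∞ k (φ.source ×ˢ univ) :=
    (hφs.comp contMDiffOn_fst fun q hq ↦ hq.1).add
      (contMDiffOn_snd.smul contMDiffOn_const)
  have hkℓ : ∀ q ∈ φ.source ×ˢ univ ∩ I.boundary M ×ˢ Ici (0 : ℝ), ℓ (k q) = q.2 := by
    rintro q ⟨hq, hq'⟩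
    simp [k, (hbd hq.1).1 hq'.1, hn]
  have hPw : ∀ w ∈ φ.source ∩ φ ⁻¹' P, F (φ w) = k (r w, s w) := by
    rintro w ⟨hw, -⟩
    simp only [F, k, φ.left_inv hw]
  refine ⟨fun q ↦ φ.symm (h (k q)), φ.source ∩ φ ⁻¹' P, φ.source ×ˢ univ ∩ k ⁻¹' Q, ?_,
    ⟨mem_extChartAt_source x₀, hvP⟩, ?_, ?_, ?_, ?_, ?_, ?_⟩
  · simpa only [hφ, extChartAt_source] using isOpen_extChartAt_preimage x₀ hP
  · exact hk.continuousOn.isOpen_inter_preimage ((isOpen_extChartAt_source x₀).prod isOpen_univ) hQ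
  · rintro w ⟨hw, hwP⟩
    have := (hNT (φ w) ⟨hPN hwP, hφ0 w⟩).2.1
    rwa [φ.left_inv hw] at this
  · rintro w ⟨hw, hwP⟩
    refine ⟨⟨?_, trivial⟩, ?_⟩
    · have := (hNT (φ w) ⟨hPN hwP, hφ0 w⟩).2.2.1
      rwa [φ.left_inv hw] at this
    · rw [mem_preimage, ← hPw w ⟨hw, hwP⟩]
      exact hFm ⟨hwP, hφ0 w⟩
  · rintro w ⟨hw, hwP⟩
    simp only [← hPw w ⟨hw, hwP⟩]
    rw [hl ⟨hwP, hφ0 w⟩, φ.left_inv hw]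
  · rintro q ⟨⟨hq, hqQ⟩, hqb⟩
    have hkq : k q ∈ Q ∩ {v | 0 ≤ ℓ v} := ⟨hqQ, by
      rw [mem_ofPred_eq, hkℓ q ⟨hq, hqb⟩]; exact hqb.2⟩
    have hv := hhm hkq
    obtain ⟨h1, h2, h3, -⟩ := hNT _ ⟨hPN hv.1, hv.2⟩
    refine ⟨⟨φ.map_target h1, by rw [mem_preimage, φ.right_inv h1]; exact hv.1⟩, ?_⟩
    have hFk : F (h (k q)) = k q := hri hkq
    have hsq : s (φ.symm (h (k q))) = q.2 := by
      rw [← hFℓ _ (hPN hv.1) hv.2, hFk, hkℓ q ⟨hq, hqb⟩]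
    refine Prod.ext (φ.injOn h3 hq.1 ?_) hsq
    simp only [F, hsq, k] at hFk
    exact add_right_cancel hFk
  · have hkm : MapsTo k (φ.source ×ˢ univ ∩ k ⁻¹' Q ∩ I.boundary M ×ˢ Ici (0 : ℝ))
        (Q ∩ {v | 0 ≤ ℓ v}) := by
      rintro q ⟨⟨hq, hqQ⟩, hqb⟩
      exact ⟨hqQ, by rw [mem_ofPred_eq, hkℓ q ⟨hq, hqb⟩]; exact hqb.2⟩
    refine (contMDiffOn_extChartAt_symm x₀).comp (hhs.contMDiffOn.comp
      (hk.mono fun q hq ↦ hq.1.1) hkm) fun q hq ↦ ?_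
    have hv := hhm (hkm hq)
    exact (hNT _ ⟨hPN hv.1, hv.2⟩).1

/-- The collar is the inverse of `w ↦ (r w, s w)` near the boundary, with time rescaled by `ε`. -/
theorem exists_isCollar [T2Space M] [CompactSpace M] (hI : IsHalfSpaceModel I) :
    ∃ c : M × ℝ → M, IsCollar I c := by
  obtain ⟨ℓ, hI⟩ := hI
  by_cases hℓ : ℓ = 0
  -- With `ℓ = 0` the model is the whole space, so the boundary is empty and every collar condition
  -- is vacuous.
  · have hX : I.boundary M = ∅ := by
      refine eq_empty_of_forall_notMem fun x hx ↦ ?_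
      have : extChartAt I x x ∈ frontier (range I) := hx
      simp [hI, hℓ] at this
    have hd : collarDomain I M = ∅ := by simp [collarDomain, hX]
    exact ⟨Prod.fst, by simp [hX], by simp [hd, ContMDiffOn], by simp [hd],
      fun x ↦ (x, 0), by simp [hd, LeftInvOn], by simp [hd, ContMDiffOn]⟩
  obtain ⟨n, hn⟩ : ∃ n, ℓ n = 1 := by
    obtain ⟨v, hv⟩ : ∃ v, ℓ v ≠ 0 := by
      by_contra! h
      exact hℓ (by ext v; simpa using h v)
    exact ⟨(ℓ v)⁻¹ • v, by simp [hv]⟩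
  obtain ⟨r, O, hr, hrfix, hO, hXO, hrO⟩ := exists_boundary_retraction (M := M) hI hn
  obtain ⟨s, hs, hs0, hsX, hsc⟩ := exists_boundary_definingFunction (M := M) hI hn
  have hX : IsCompact (I.boundary M) := (I.isClosed_boundary (n := ∞) (by simp)).isCompact
  choose! h P Q hP hxP hQ hPO hPQ hhl hhr hhs using fun (x : M) (hx : x ∈ I.boundary M) ↦
    exists_local_inverse_retraction_prod hI hn hr hrfix hO hXO hrO hs hsX hx (hsc x hx)
  let F : M → M × ℝ := fun w ↦ (r w, s w)
  have hF : ContMDiff I (I.prod 𝓘(ℝ, ℝ)) ∞ F := hr.prodMk hs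
  have hFX : ∀ x ∈ I.boundary M, F x = (x, 0) := fun x hx ↦ by simp [F, hrfix x hx, hsX x hx]
  -- Injectivity on a compact set together with injectivity near each of its points gives
  -- injectivity on a neighbourhood of the set.
  obtain ⟨W₀, hW₀, hinj₀⟩ := Set.InjOn.exists_mem_nhdsSet (f := F) (s := I.boundary M)
    (fun x hx y hy hxy ↦ by rw [hFX x hx, hFX y hy] at hxy; exact (Prod.ext_iff.1 hxy).1) hX
    (fun x _ ↦ hF.continuous.continuousAt)
    (fun x hx ↦ ⟨P x, (hP x hx).mem_nhds (hxP x hx), fun w hw w' hw' heq ↦ by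
      rw [← hhl x hx w hw, ← hhl x hx w' hw']; exact congrArg (h x) heq⟩)
  let W : Set M := interior W₀ ∩ ⋃ x ∈ I.boundary M, P x
  have hWo : IsOpen W := isOpen_interior.inter (isOpen_biUnion hP)
  have hXW : I.boundary M ⊆ W := fun x hx ↦
    ⟨subset_interior_iff_mem_nhdsSet.2 hW₀ hx, mem_biUnion hx (hxP x hx)⟩
  have hinj : InjOn F W := hinj₀.mono (inter_subset_left.trans interior_subset)
  let D : Set (M × ℝ) := I.boundary M ×ˢ Ici 0
  obtain ⟨ε, hε, hsurj⟩ : ∃ ε > 0, ∀ x ∈ I.boundary M ∩ I.boundary M, ∀ t ∈ Ico 0 ε,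
      (x, t) ∈ F '' W := by
    refine hX.induction_on (p := fun S ↦ ∃ ε > (0 : ℝ), ∀ x ∈ I.boundary M ∩ S, ∀ t ∈ Ico 0 ε,
      (x, t) ∈ F '' W) ⟨1, one_pos, by simp⟩ ?_ ?_ ?_
    · rintro S T hST ⟨ε, hε, h⟩
      exact ⟨ε, hε, fun x hx ↦ h x ⟨hx.1, hST hx.2⟩⟩
    · rintro S T ⟨ε, hε, h⟩ ⟨ε', hε', h'⟩
      refine ⟨min ε ε', lt_min hε hε', ?_⟩
      rintro x ⟨hx, hxS | hxT⟩ t ht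
      · exact h x ⟨hx, hxS⟩ t ⟨ht.1, ht.2.trans_le (min_le_left _ _)⟩
      · exact h' x ⟨hx, hxT⟩ t ⟨ht.1, ht.2.trans_le (min_le_right _ _)⟩
    · intro x hx
      have hq : (x, (0 : ℝ)) ∈ Q x := by rw [← hFX x hx]; exact hPQ x hx x (hxP x hx)
      have h1 := ((hhs x hx).continuousOn (x, 0) ⟨hq, hx, le_refl (0 : ℝ)⟩).eventually_mem
        (s := W) (by
          have h2 : h x (x, 0) = x := by
            rw [← hFX x hx]
            exact hhl x hx x (hxP x hx)
          rw [h2]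
          exact hWo.mem_nhds (hXW hx))
      have h3 : ∀ᶠ q in 𝓝 (x, (0 : ℝ)), q ∈ D → q ∈ F '' W := by
        filter_upwards [eventually_nhdsWithin_iff.1 h1, (hQ x hx).mem_nhds hq] with q hq1 hq2 hqD
        exact ⟨h x q, hq1 ⟨hq2, hqD⟩, (hhr x hx q ⟨hq2, hqD⟩).2⟩
      obtain ⟨U, hU, T, hT, hUT⟩ := mem_nhds_prod_iff.1 h3
      obtain ⟨ε, hε, hεT⟩ := Metric.mem_nhds_iff.1 hT
      refine ⟨U, mem_nhdsWithin_of_mem_nhds hU, ε, hε, fun y hy t ht ↦ ?_⟩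
      exact hUT (mk_mem_prod hy.2 (hεT (by simpa [abs_of_nonneg ht.1] using ht.2)))
        ⟨hy.1, ht.1⟩
  rw [inter_self] at hsurj
  rcases isEmpty_or_nonempty M with hM | hM
  · exact ⟨Prod.fst, fun x ↦ isEmptyElim x, fun x ↦ isEmptyElim x.1,
      by simp [Subsingleton.elim (_ : Set M) ∅], fun x ↦ (x, 0), fun x ↦ isEmptyElim x.1,
      fun x ↦ isEmptyElim x⟩
  let m : M × ℝ → M × ℝ := fun q ↦ (q.1, ε * q.2)
  have hm : ContMDiff (I.prod 𝓘(ℝ, ℝ)) (I.prod 𝓘(ℝ, ℝ)) ∞ m :=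
    contMDiff_fst.prodMk ((contMDiff_const (c := ε)).mul contMDiff_snd)
  have hmD : MapsTo m (collarDomain I M) D := fun q hq ↦ ⟨hq.1, mul_nonneg hε.le hq.2.1⟩
  have hmW : ∀ q ∈ collarDomain I M, m q ∈ F '' W := fun q hq ↦
    hsurj q.1 hq.1 _ ⟨mul_nonneg hε.le hq.2.1, by nlinarith [hq.2.2]⟩
  let c : M × ℝ → M := fun q ↦ Function.invFunOn F W (m q)
  have hcW : ∀ q ∈ collarDomain I M, c q ∈ W := fun q hq ↦ Function.invFunOn_mem (hmW q hq)
  have hcF : ∀ q ∈ collarDomain I M, F (c q) = m q := fun q hq ↦ Function.invFunOn_eq (hmW q hq)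
  have hc_eq : ∀ q ∈ collarDomain I M, ∀ w ∈ W, F w = m q → c q = w := fun q hq w hw hwq ↦
    hinj (hcW q hq) hw ((hcF q hq).trans hwq.symm)
  refine ⟨c, fun x hx ↦ ?_, fun q₁ hq₁ ↦ ?_, ?_, fun w ↦ (r w, s w / ε), fun q hq ↦ ?_, ?_⟩
  · refine hc_eq (x, 0) ⟨hx, by simp⟩ x (hXW hx) ?_
    simp [hFX x hx, m]
  -- The chosen inverse need not come from one local formula, but near `q₁` it agrees with the
  -- smooth local inverse `h x ∘ m`, by injectivity of `F` on `W`.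
  · obtain ⟨x, hx, hxP'⟩ := mem_iUnion₂.1 (hcW q₁ hq₁).2
    have hq₁Q : m q₁ ∈ Q x := by rw [← hcF q₁ hq₁]; exact hPQ x hx _ hxP'
    have hh₁ : h x (m q₁) = c q₁ := by rw [← hcF q₁ hq₁]; exact hhl x hx _ hxP'
    have h1 : ContMDiffWithinAt (I.prod 𝓘(ℝ, ℝ)) I ∞ (h x) D (m q₁) := by
      have := hhs x hx (m q₁) ⟨hq₁Q, hmD hq₁⟩
      rw [inter_comm] at this
      exact (contMDiffWithinAt_inter ((hQ x hx).mem_nhds hq₁Q)).1 this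
    have h2 : ContMDiffWithinAt (I.prod 𝓘(ℝ, ℝ)) I ∞ (h x ∘ m) (collarDomain I M) q₁ :=
      h1.comp q₁ hm.contMDiffAt.contMDiffWithinAt hmD
    refine h2.congr_of_eventuallyEq ?_ hh₁.symm
    have h3 : ∀ᶠ q in 𝓝[collarDomain I M] q₁, h x (m q) ∈ W :=
      h2.continuousWithinAt.eventually_mem (by
        rw [Function.comp_apply, hh₁]; exact hWo.mem_nhds (hcW q₁ hq₁))
    have h4 : ∀ᶠ q in 𝓝[collarDomain I M] q₁, m q ∈ Q x :=
      (hm.continuous.continuousAt.eventually_mem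
        ((hQ x hx).mem_nhds hq₁Q)).filter_mono nhdsWithin_le_nhds
    filter_upwards [h3, h4, self_mem_nhdsWithin] with q h5 h6 h7
    exact hc_eq q h7 _ h5 (hhr x hx (m q) ⟨h6, hmD h7⟩).2
  · have : c '' collarDomain I M = W ∩ s ⁻¹' Iio ε := by
      ext w
      constructor
      · rintro ⟨q, hq, rfl⟩
        refine ⟨hcW q hq, ?_⟩
        have : s (c q) = ε * q.2 := congrArg Prod.snd (hcF q hq)
        rw [mem_preimage, this, mem_Iio]
        nlinarith [hq.2.2]
      · rintro ⟨hw, hws⟩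
        obtain ⟨x, hx, hxP'⟩ := mem_iUnion₂.1 hw.2
        have hq : (r w, s w / ε) ∈ collarDomain I M :=
          ⟨hrO (hPO x hx hxP'), div_nonneg (hs0 w) hε.le, (div_lt_one hε).2 hws⟩
        refine ⟨_, hq, hc_eq _ hq w hw ?_⟩
        simp only [F, m, Prod.mk.injEq, true_and]
        field_simp
    rw [this]
    exact hWo.inter (isOpen_Iio.preimage hs.continuous)
  · have := hcF q hq
    simp only [F, m, Prod.mk.injEq] at this
    simp [this.1, this.2, hε.ne']
  · exact (hr.prodMk (hs.div_const ε)).contMDiffOn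

end CollarExistence

/-! ### Points of the total space over the collar -/

section CollarGraph

variable {V H B E : Type*} [NormedAddCommGroup V] [NormedSpace ℝ V] [TopologicalSpace H]
  (I : ModelWithCorners ℝ V H) [TopologicalSpace B] [ChartedSpace H B] (p : E → B) (cB : B × ℝ → B)

/-- The pairs `(e, t)` with `t ∈ [0, α)` such that `e` lies over `cB (x, τ x * t)` for a boundary
point `x`. -/
def collarGraph (α : ℝ) (τ : B → ℝ) : Set (E × ℝ) :=
  {q | q.2 ∈ Ico 0 α ∧ ∃ x ∈ I.boundary B, p q.1 = cB (x, τ x * q.2)}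

theorem collarGraph_mono {α α' : ℝ} (h : α' ≤ α) (τ : B → ℝ) :
    collarGraph I p cB α' τ ⊆ collarGraph I p cB α τ :=
  fun _ hq ↦ ⟨⟨hq.1.1, hq.1.2.trans_le h⟩, hq.2⟩

end CollarGraph

/-! ### Fibre bundles over a base with a collar -/

section BundleCollar

variable {V H B : Type*} [NormedAddCommGroup V] [NormedSpace ℝ V] [TopologicalSpace H]
  {I : ModelWithCorners ℝ V H} [TopologicalSpace B] [ChartedSpace H B]
  {V' H' E : Type*} [NormedAddCommGroup V'] [NormedSpace ℝ V'] [TopologicalSpace H']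
  {J : ModelWithCorners ℝ V' H'} [TopologicalSpace E] [ChartedSpace H' E]
  {V'' H'' L : Type*} [NormedAddCommGroup V''] [NormedSpace ℝ V''] [TopologicalSpace H'']
  {K : ModelWithCorners ℝ V'' H''} [TopologicalSpace L] [ChartedSpace H'' L]
  {p : E → B}

/-- The boundary of the total space of a bundle with boundaryless fibre lies over the boundary of
the base. -/
theorem IsSmoothFiberBundle.mem_boundary_iff [BoundarylessManifold K L]
    (hp : IsSmoothFiberBundle I J K L p) (e : E) :
    e ∈ J.boundary E ↔ p e ∈ I.boundary B := by
  obtain ⟨φ, hφ, h1, h2⟩ := hp.locallyTrivial (p e)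
  let Φ : PartialDiffeomorph J (I.prod K) E (B × L) ∞ :=
    { toPartialEquiv := φ.toPartialEquiv
      open_source := φ.open_source
      open_target := φ.open_target
      contMDiffOn_toFun := h1
      contMDiffOn_invFun := h2 }
  have he : e ∈ φ.source := φ.mem_source.2 hφ
  have hloc : IsLocalDiffeomorphAt J (I.prod K) ∞ φ e := ⟨Φ, he, fun _ _ ↦ rfl⟩
  have h3 := hloc.isBoundaryPoint_iff (by simp)
  have h4 : φ e ∈ (I.prod K).boundary (B × L) ↔ p e ∈ I.boundary B := by
    rw [ModelWithCorners.boundary_of_boundaryless_right]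
    change (φ e).1 ∈ _ ∧ (φ e).2 ∈ univ ↔ _
    rw [φ.coe_fst he]
    simp
  exact h3.trans h4

/-! ### Transport along the base collar -/

variable {cB : B × ℝ → B}

variable (I J p cB) in
/-- `Q` moves the points over `cB (x, τ x * t)` smoothly to points over `cB (x, τ' x * t)`. -/
structure IsCollarTransport (α : ℝ) (τ τ' : B → ℝ) (Q : E × ℝ → E) : Prop where
  contMDiffOn : ContMDiffOn (J.prod 𝓘(ℝ, ℝ)) J ∞ Q (collarGraph I p cB α τ)
  apply_proj : ∀ x ∈ I.boundary B, ∀ t ∈ Ico 0 α, ∀ e, p e = cB (x, τ x * t) →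
    p (Q (e, t)) = cB (x, τ' x * t)
  apply_zero : ∀ e, p e ∈ I.boundary B → Q (e, 0) = e

variable (I J p cB) in
/-- There are mutually inverse smooth transports between the points over `cB (x, τ x * t)` and the
points over `cB (x, τ' x * t)`. -/
def CollarTransportable (α : ℝ) (τ τ' : B → ℝ) : Prop :=
  ∃ Q Q' : E × ℝ → E, IsCollarTransport I J p cB α τ τ' Q ∧
    IsCollarTransport I J p cB α τ' τ Q' ∧
    (∀ q ∈ collarGraph I p cB α τ, Q' (Q q, q.2) = q.1) ∧
    ∀ q ∈ collarGraph I p cB α τ', Q (Q' q, q.2) = q.1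

theorem IsCollarTransport.mono {α α' : ℝ} {τ τ' : B → ℝ} {Q : E × ℝ → E}
    (hQ : IsCollarTransport I J p cB α τ τ' Q) (h : α' ≤ α) :
    IsCollarTransport I J p cB α' τ τ' Q :=
  ⟨hQ.1.mono (collarGraph_mono I p cB h τ),
    fun x hx t ht ↦ hQ.2 x hx t ⟨ht.1, ht.2.trans_le h⟩, hQ.3⟩

theorem IsCollarTransport.mapsTo {α : ℝ} {τ τ' : B → ℝ} {Q : E × ℝ → E}
    (hQ : IsCollarTransport I J p cB α τ τ' Q) :
    MapsTo (fun q ↦ (Q q, q.2)) (collarGraph I p cB α τ) (collarGraph I p cB α τ') := by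
  rintro ⟨e, t⟩ ⟨ht, x, hx, he⟩
  exact ⟨ht, x, hx, hQ.apply_proj x hx t ht e he⟩

theorem IsCollarTransport.comp {α : ℝ} {τ₁ τ₂ τ₃ : B → ℝ} {Q Q' : E × ℝ → E}
    (hQ' : IsCollarTransport I J p cB α τ₂ τ₃ Q') (hQ : IsCollarTransport I J p cB α τ₁ τ₂ Q) :
    IsCollarTransport I J p cB α τ₁ τ₃ (fun q ↦ Q' (Q q, q.2)) where
  contMDiffOn := hQ'.contMDiffOn.comp (hQ.contMDiffOn.prodMk contMDiffOn_snd) hQ.mapsTo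
  apply_proj x hx t ht e he := hQ'.apply_proj x hx t ht _ (hQ.apply_proj x hx t ht e he)
  apply_zero e he := by simp only [hQ.apply_zero e he, hQ'.apply_zero e he]

theorem CollarTransportable.mono {α α' : ℝ} {τ τ' : B → ℝ}
    (h : CollarTransportable I J p cB α τ τ') (hα : α' ≤ α) :
    CollarTransportable I J p cB α' τ τ' := by
  obtain ⟨Q, Q', h1, h2, h3, h4⟩ := h
  exact ⟨Q, Q', h1.mono hα, h2.mono hα, fun q hq ↦ h3 q (collarGraph_mono I p cB hα τ hq),
    fun q hq ↦ h4 q (collarGraph_mono I p cB hα τ' hq)⟩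

theorem CollarTransportable.refl (α : ℝ) (τ : B → ℝ) : CollarTransportable I J p cB α τ τ := by
  have h : IsCollarTransport I J p cB α τ τ Prod.fst :=
    ⟨contMDiffOn_fst, fun _ _ _ _ _ he ↦ he, fun _ _ ↦ rfl⟩
  exact ⟨Prod.fst, Prod.fst, h, h, fun _ _ ↦ rfl, fun _ _ ↦ rfl⟩

theorem CollarTransportable.trans {α : ℝ} {τ₁ τ₂ τ₃ : B → ℝ}
    (h : CollarTransportable I J p cB α τ₁ τ₂) (h' : CollarTransportable I J p cB α τ₂ τ₃) :
    CollarTransportable I J p cB α τ₁ τ₃ := by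
  obtain ⟨Q, Q', h1, h2, h3, h4⟩ := h
  obtain ⟨R, R', k1, k2, k3, k4⟩ := h'
  refine ⟨_, _, k1.comp h1, h2.comp k2, fun q hq ↦ ?_, fun q hq ↦ ?_⟩
  · have := k3 _ (h1.mapsTo hq)
    simp only at this ⊢
    rw [this, h3 q hq]
  · have := h4 _ (k2.mapsTo hq)
    simp only at this ⊢
    rw [this, k4 q hq]

/-- The projections of the inverse of a collar. -/
theorem IsCollar.exists_projections {c : B × ℝ → B} (hc : IsCollar I c) :
    ∃ (r : B → B) (s : B → ℝ), ContMDiffOn I I ∞ r (c '' collarDomain I B) ∧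
      ContMDiffOn I 𝓘(ℝ, ℝ) ∞ s (c '' collarDomain I B) ∧
      ∀ x ∈ I.boundary B, ∀ t ∈ Ico (0 : ℝ) 1, r (c (x, t)) = x ∧ s (c (x, t)) = t := by
  obtain ⟨g, hg, hg'⟩ := hc.exists_smooth_inverse
  refine ⟨fun b ↦ (g b).1, fun b ↦ (g b).2, contMDiff_fst.comp_contMDiffOn hg',
    contMDiff_snd.comp_contMDiffOn hg', fun x hx t ht ↦ ?_⟩
  simp only [hg (show (x, t) ∈ collarDomain I B from ⟨hx, ht⟩)]
  exact ⟨trivial, trivial⟩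

/-- In a local trivialization, points can be moved along the collar of the base. -/
theorem isCollarTransport_of_trivialization (hp : ContMDiff J I ∞ p) (hcB : IsCollar I cB)
    {r : B → B} (hr : ContMDiffOn I I ∞ r (cB '' collarDomain I B))
    (hrc : ∀ x ∈ I.boundary B, ∀ t ∈ Ico (0 : ℝ) 1, r (cB (x, t)) = x)
    (φ : Bundle.Trivialization L p) (h₁ : ContMDiffOn J (I.prod K) ∞ φ φ.source)
    (h₂ : ContMDiffOn (I.prod K) J ∞ φ.toOpenPartialHomeomorph.symm φ.target) {α : ℝ} (hα₀ : 0 < α) (hα : α ≤ 1)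
    {G A : Set B} (hG : IsOpen G) (hA : IsClosed A) (hAG : A ⊆ G)
    (hGφ : ∀ x ∈ I.boundary B ∩ G, ∀ t ∈ Ico 0 α, cB (x, t) ∈ φ.baseSet) {τ τ' : B → ℝ}
    (hτ : ∀ x, τ x ∈ Icc (0 : ℝ) 1) (hτ' : ∀ x, τ' x ∈ Icc (0 : ℝ) 1)
    (hτs' : ContMDiff I 𝓘(ℝ, ℝ) ∞ τ') (hττ' : ∀ x ∉ A, τ' x = τ x)
    {Q : E × ℝ → E} (hQG : ∀ q, r (p q.1) ∈ G → Q q = φ.toOpenPartialHomeomorph.symm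
      (cB (r (p q.1), τ' (r (p q.1)) * q.2), (φ q.1).2))
    (hQ : ∀ q, r (p q.1) ∉ G → Q q = q.1) :
    IsCollarTransport I J p cB α τ τ' Q := by
  have hmul : ∀ {σ : B → ℝ}, (∀ x, σ x ∈ Icc (0 : ℝ) 1) → ∀ x, ∀ t ∈ Ico 0 α,
      σ x * t ∈ Ico 0 α := fun hσ x t ht ↦
    ⟨mul_nonneg (hσ x).1 ht.1, (mul_le_of_le_one_left ht.1 (hσ x).2).trans_lt ht.2⟩
  have hIco : Ico 0 α ⊆ Ico 0 1 := Ico_subset_Ico_right hα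
  have hre : ∀ x ∈ I.boundary B, ∀ t ∈ Ico 0 α, ∀ e, p e = cB (x, τ x * t) → r (p e) = x :=
    fun x hx t ht e he ↦ by rw [he]; exact hrc x hx _ (hIco (hmul hτ x t ht))
  have hsource : ∀ x ∈ I.boundary B ∩ G, ∀ t ∈ Ico 0 α, ∀ e, p e = cB (x, τ x * t) →
      e ∈ φ.source := fun x hx t ht e he ↦ by
    rw [φ.mem_source, he]; exact hGφ x hx _ (hmul hτ x t ht)
  -- Keeping both the base point and the fibre coordinate does nothing, so the two branches of `Q`
  -- agree where `τ' = τ`. This gives smoothness across the edge of `G`, since `A` is closed and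
  -- contained in `G`.
  have hsame : ∀ x ∈ I.boundary B, ∀ t ∈ Ico 0 α, ∀ e, p e = cB (x, τ x * t) →
      τ' x * t = τ x * t → Q (e, t) = e := by
    intro x hx t ht e he heq
    by_cases hxG : x ∈ G
    · have he' := hre x hx t ht e he
      rw [hQG (e, t) (by rwa [he'])]
      simp only [he', heq]
      rw [← he]
      exact φ.symm_apply_mk_proj (hsource x ⟨hx, hxG⟩ t ht e he)
    · exact hQ (e, t) (by rwa [hre x hx t ht e he])
  refine ⟨?_, fun x hx t ht e he ↦ ?_, fun e he ↦ ?_⟩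
  · let R : E × ℝ → B := fun q ↦ r (p q.1)
    have hpU : MapsTo (fun q : E × ℝ ↦ p q.1) (collarGraph I p cB α τ)
        (cB '' collarDomain I B) := by
      rintro ⟨e, t⟩ ⟨ht, x, hx, he⟩
      exact ⟨_, ⟨hx, hIco (hmul hτ x t ht)⟩, he.symm⟩
    have hR : ContMDiffOn (J.prod 𝓘(ℝ, ℝ)) I ∞ R (collarGraph I p cB α τ) :=
      hr.comp (hp.comp_contMDiffOn contMDiffOn_fst) hpU
    rintro ⟨e₀, t₀⟩ hq₀
    obtain ⟨ht₀, x₀, hx₀, he₀⟩ := id hq₀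
    have hR₀ : R (e₀, t₀) = x₀ := hre x₀ hx₀ t₀ ht₀ e₀ he₀
    have hRc := (hR _ hq₀).continuousWithinAt
    by_cases hxG : x₀ ∈ G
    · have he₀s : e₀ ∈ φ.source := hsource x₀ ⟨hx₀, hxG⟩ t₀ ht₀ e₀ he₀
      have hm : ContMDiffOn (J.prod 𝓘(ℝ, ℝ)) (I.prod 𝓘(ℝ, ℝ)) ∞
          (fun q : E × ℝ ↦ (R q, τ' (R q) * q.2)) (collarGraph I p cB α τ) :=
        hR.prodMk ((hτs'.comp_contMDiffOn hR).mul contMDiffOn_snd)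
      have hmm : MapsTo (fun q : E × ℝ ↦ (R q, τ' (R q) * q.2)) (collarGraph I p cB α τ)
          (collarDomain I B) := by
        rintro ⟨e, t⟩ ⟨ht, x, hx, he⟩
        have : R (e, t) = x := hre x hx t ht e he
        simp only [this]
        exact ⟨hx, hIco (hmul hτ' x t ht)⟩
      have hφ2 : ContMDiffWithinAt (J.prod 𝓘(ℝ, ℝ)) K ∞ (fun q : E × ℝ ↦ (φ q.1).2)
          (collarGraph I p cB α τ) (e₀, t₀) := by
        have h3 : ContMDiffAt J K ∞ (fun e ↦ (φ e).2) e₀ :=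
          contMDiffAt_snd.comp e₀ (h₁.contMDiffAt (φ.open_source.mem_nhds he₀s))
        exact ContMDiffAt.comp_contMDiffWithinAt (f := Prod.fst) (e₀, t₀) h3 contMDiffWithinAt_fst
      have hpair := ((hcB.contMDiffOn.comp hm hmm) _ hq₀).prodMk hφ2
      have htar : (cB (R (e₀, t₀), τ' (R (e₀, t₀)) * t₀), (φ e₀).2) ∈ φ.target := by
        rw [φ.mem_target, hR₀]
        exact hGφ x₀ ⟨hx₀, hxG⟩ _ (hmul hτ' x₀ t₀ ht₀)
      have hcomp := (h₂.contMDiffAt (φ.open_target.mem_nhds htar)).comp_contMDiffWithinAt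
        (e₀, t₀) hpair
      refine hcomp.congr_of_eventuallyEq ?_ (hQG _ (by rw [← hR₀] at hxG; exact hxG))
      filter_upwards [hRc.eventually_mem (by rw [hR₀]; exact hG.mem_nhds hxG)] with q hq
      exact hQG q hq
    · have hxA : x₀ ∉ A := fun h ↦ hxG (hAG h)
      refine contMDiffWithinAt_fst.congr_of_eventuallyEq_of_mem ?_ hq₀
      filter_upwards [hRc.eventually_mem (s := Aᶜ) (by
        rw [hR₀]; exact hA.isOpen_compl.mem_nhds hxA), self_mem_nhdsWithin] with q hq hqΓ
      obtain ⟨ht, x, hx, he⟩ := hqΓ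
      have hRq : R q = x := hre x hx q.2 ht q.1 he
      rw [hRq] at hq
      exact hsame x hx q.2 ht q.1 he (by rw [hττ' x hq])
  · have he' := hre x hx t ht e he
    by_cases hxG : x ∈ G
    · rw [hQG (e, t) (by rwa [he'])]
      simp only [he']
      exact φ.proj_symm_apply' (hGφ x ⟨hx, hxG⟩ _ (hmul hτ' x t ht))
    · rw [hQ (e, t) (by rwa [he']), he, hττ' x fun h ↦ hxG (hAG h)]
  · exact hsame (p e) he 0 ⟨le_rfl, hα₀⟩ e (by simp [hcB.apply_zero _ he]) (by simp)

/-- The transport keeps the fibre coordinate of `φ` over `G` and is the identity elsewhere. Its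
formula depends only on the target function, so exchanging `τ` and `τ'` gives the inverse. -/
theorem collarTransportable_of_trivialization (hp : ContMDiff J I ∞ p) (hcB : IsCollar I cB)
    (φ : Bundle.Trivialization L p) (h₁ : ContMDiffOn J (I.prod K) ∞ φ φ.source)
    (h₂ : ContMDiffOn (I.prod K) J ∞ φ.toOpenPartialHomeomorph.symm φ.target) {α : ℝ}
    (hα₀ : 0 < α) (hα : α ≤ 1) {G A : Set B} (hG : IsOpen G) (hA : IsClosed A) (hAG : A ⊆ G)
    (hGφ : ∀ x ∈ I.boundary B ∩ G, ∀ t ∈ Ico 0 α, cB (x, t) ∈ φ.baseSet) {τ τ' : B → ℝ}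
    (hτ : ∀ x, τ x ∈ Icc (0 : ℝ) 1) (hτ' : ∀ x, τ' x ∈ Icc (0 : ℝ) 1)
    (hτs : ContMDiff I 𝓘(ℝ, ℝ) ∞ τ) (hτs' : ContMDiff I 𝓘(ℝ, ℝ) ∞ τ')
    (hττ' : ∀ x ∉ A, τ' x = τ x) : CollarTransportable I J p cB α τ τ' := by
  classical
  obtain ⟨r, _, hr, _, hrs⟩ := hcB.exists_projections
  have hrc : ∀ x ∈ I.boundary B, ∀ t ∈ Ico (0 : ℝ) 1, r (cB (x, t)) = x :=
    fun x hx t ht ↦ (hrs x hx t ht).1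
  let Q : (B → ℝ) → E × ℝ → E := fun σ q ↦ if r (p q.1) ∈ G then
    φ.toOpenPartialHomeomorph.symm (cB (r (p q.1), σ (r (p q.1)) * q.2), (φ q.1).2) else q.1
  have hQ₁ : ∀ σ q, r (p q.1) ∈ G → Q σ q = φ.toOpenPartialHomeomorph.symm
      (cB (r (p q.1), σ (r (p q.1)) * q.2), (φ q.1).2) := fun σ q h ↦ if_pos h
  have hQ₂ : ∀ σ q, r (p q.1) ∉ G → Q σ q = q.1 := fun σ q h ↦ if_neg h
  have hinv : ∀ {σ σ' : B → ℝ}, (∀ x, σ x ∈ Icc (0 : ℝ) 1) → (∀ x, σ' x ∈ Icc (0 : ℝ) 1) →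
      ∀ q ∈ collarGraph I p cB α σ, Q σ (Q σ' q, q.2) = q.1 := by
    rintro σ σ' hσ hσ' ⟨e, t⟩ ⟨ht, x, hx, he⟩
    have hmul : ∀ {σ : B → ℝ}, (∀ x, σ x ∈ Icc (0 : ℝ) 1) → σ x * t ∈ Ico 0 α := fun hσ ↦
      ⟨mul_nonneg (hσ x).1 ht.1, (mul_le_of_le_one_left ht.1 (hσ x).2).trans_lt ht.2⟩
    have hre : ∀ {σ : B → ℝ}, (∀ x, σ x ∈ Icc (0 : ℝ) 1) → ∀ e, p e = cB (x, σ x * t) →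
        r (p e) = x := fun hσ e he ↦ by
      rw [he]; exact hrc x hx _ (Ico_subset_Ico_right hα (hmul hσ))
    simp only at he ⊢
    have he' := hre hσ e he
    by_cases hxG : x ∈ G
    · have hes : e ∈ φ.source := by rw [φ.mem_source, he]; exact hGφ x ⟨hx, hxG⟩ _ (hmul hσ)
      have hb : cB (x, σ' x * t) ∈ φ.baseSet := hGφ x ⟨hx, hxG⟩ _ (hmul hσ')
      have h1 : Q σ' (e, t) = φ.toOpenPartialHomeomorph.symm (cB (x, σ' x * t), (φ e).2) := by
        rw [hQ₁ σ' (e, t) (by rwa [he'])]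
        simp only [he']
      have h2 : p (Q σ' (e, t)) = cB (x, σ' x * t) := by rw [h1]; exact φ.proj_symm_apply' hb
      have h3 : φ (Q σ' (e, t)) = (cB (x, σ' x * t), (φ e).2) := by
        rw [h1]; exact φ.apply_symm_apply' hb
      have h4 := hre hσ' _ h2
      rw [hQ₁ σ _ (by rwa [h4])]
      simp only [h4, h3]
      rw [← he]
      exact φ.symm_apply_mk_proj hes
    · have h1 : Q σ' (e, t) = e := hQ₂ σ' (e, t) (by rwa [he'])
      rw [h1]
      exact hQ₂ σ (e, t) (by rwa [he'])
  exact ⟨Q τ', Q τ,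
    isCollarTransport_of_trivialization hp hcB hr hrc φ h₁ h₂ hα₀ hα hG hA hAG hGφ hτ hτ' hτs' hττ'
      (hQ₁ τ') (hQ₂ τ'),
    isCollarTransport_of_trivialization hp hcB hr hrc φ h₁ h₂ hα₀ hα hG hA hAG hGφ hτ' hτ hτs
      (fun x hx ↦ (hττ' x hx).symm) (hQ₁ τ) (hQ₂ τ), hinv hτ hτ', hinv hτ' hτ⟩

theorem add_mul_one_sub_mem_Icc {a b : ℝ} (ha : a ∈ Icc (0 : ℝ) 1) (hb : b ∈ Icc (0 : ℝ) 1) :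
    a + b * (1 - a) ∈ Icc (0 : ℝ) 1 :=
  ⟨add_nonneg ha.1 (mul_nonneg hb.1 (sub_nonneg.2 ha.2)), by nlinarith [ha.1, ha.2, hb.1, hb.2]⟩

/-- Points over the boundary can be moved along the collar of the base, for a short time. -/
theorem exists_collarTransportable [FiniteDimensional ℝ V] [IsManifold I ∞ B] [T2Space B]
    [CompactSpace B] (hp : IsSmoothFiberBundle I J K L p) (hcB : IsCollar I cB) :
    ∃ α ∈ Ioc (0 : ℝ) 1, ∃ χ : B → ℝ, (∀ x ∈ I.boundary B, χ x = 1) ∧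
      CollarTransportable I J p cB α (fun _ ↦ 0) χ := by
  -- Allowing an arbitrary starting function `τ` makes the claim composable, as the compactness
  -- induction requires.
  suffices h : ∃ α ∈ Ioc (0 : ℝ) 1, ∃ χ : B → ℝ, ContMDiff I 𝓘(ℝ, ℝ) ∞ χ ∧
      (∀ x, χ x ∈ Icc (0 : ℝ) 1) ∧ (∀ x ∈ I.boundary B ∩ I.boundary B, χ x = 1) ∧
      ∀ τ : B → ℝ, ContMDiff I 𝓘(ℝ, ℝ) ∞ τ → (∀ x, τ x ∈ Icc (0 : ℝ) 1) →
        CollarTransportable I J p cB α τ (fun x ↦ τ x + χ x * (1 - τ x)) by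
    obtain ⟨α, hα, χ, -, -, hχ1, h⟩ := h
    refine ⟨α, hα, χ, fun x hx ↦ hχ1 x ⟨hx, hx⟩, ?_⟩
    simpa using h (fun _ ↦ 0) contMDiff_const (by simp)
  have hX : IsCompact (I.boundary B) := (I.isClosed_boundary (n := ∞) (by simp)).isCompact
  refine hX.induction_on (p := fun S ↦ ∃ α ∈ Ioc (0 : ℝ) 1, ∃ χ : B → ℝ,
    ContMDiff I 𝓘(ℝ, ℝ) ∞ χ ∧ (∀ x, χ x ∈ Icc (0 : ℝ) 1) ∧ (∀ x ∈ I.boundary B ∩ S, χ x = 1) ∧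
      ∀ τ : B → ℝ, ContMDiff I 𝓘(ℝ, ℝ) ∞ τ → (∀ x, τ x ∈ Icc (0 : ℝ) 1) →
        CollarTransportable I J p cB α τ (fun x ↦ τ x + χ x * (1 - τ x))) ?_ ?_ ?_ ?_
  · refine ⟨1, by simp, fun _ ↦ 0, contMDiff_const, by simp, by simp, fun τ _ _ ↦ ?_⟩
    simpa using CollarTransportable.refl 1 τ
  · rintro S T hST ⟨α, hα, χ, h1, h2, h3, h4⟩
    exact ⟨α, hα, χ, h1, h2, fun x hx ↦ h3 x ⟨hx.1, hST hx.2⟩, h4⟩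
  · rintro S T ⟨α, hα, χ, h1, h2, h3, h4⟩ ⟨α', hα', χ', h1', h2', h3', h4'⟩
    refine ⟨min α α', ⟨lt_min hα.1 hα'.1, (min_le_left _ _).trans hα.2⟩,
      -- Raising by `χ` and then by `χ'` leaves the gap `(1 - χ) * (1 - χ')` to `1`, which vanishes
      -- where either function is `1`.
      fun x ↦ χ x + χ' x * (1 - χ x), h1.add (h1'.mul (contMDiff_const.sub h1)),
      fun x ↦ add_mul_one_sub_mem_Icc (h2 x) (h2' x), ?_, fun τ hτs hτ ↦ ?_⟩
    · rintro x ⟨hx, hxS | hxT⟩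
      · simp [h3 x ⟨hx, hxS⟩]
      · simp [h3' x ⟨hx, hxT⟩]
    · have := ((h4 τ hτs hτ).mono (min_le_left α α')).trans
        ((h4' _ (hτs.add (h1.mul (contMDiff_const.sub hτs)))
          fun x ↦ add_mul_one_sub_mem_Icc (hτ x) (h2 x)).mono (min_le_right α α'))
      convert this using 2 with x
      simp only [Pi.add_apply, Pi.mul_apply]
      ring
  · intro x₀ hx₀
    obtain ⟨φ, hφ, h₁, h₂⟩ := hp.locallyTrivial x₀
    have h3 : ∀ᶠ q in 𝓝[collarDomain I B] (x₀, (0 : ℝ)), cB q ∈ φ.baseSet := by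
      refine (hcB.contMDiffOn.continuousOn (x₀, 0) ⟨hx₀, by simp⟩).eventually_mem ?_
      rw [hcB.apply_zero x₀ hx₀]
      exact φ.open_baseSet.mem_nhds hφ
    obtain ⟨U, hU, T, hT, hUT⟩ := mem_nhds_prod_iff.1 (eventually_nhdsWithin_iff.1 h3)
    obtain ⟨δ, hδ, hδT⟩ := Metric.mem_nhds_iff.1 hT
    obtain ⟨G, hGU, hG, hxG⟩ := mem_nhds_iff.1 hU
    obtain ⟨ψ, -, hψ⟩ := (SmoothBumpFunction.nhds_basis_tsupport (I := I) x₀).mem_iff.1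
      (hG.mem_nhds hxG)
    have hψI : ∀ x, ψ x ∈ Icc (0 : ℝ) 1 := fun _ ↦ ψ.mem_Icc
    refine ⟨{x | ψ x = 1}, mem_nhdsWithin_of_mem_nhds ψ.eventuallyEq_one, min δ 1,
      ⟨lt_min hδ one_pos, min_le_right _ _⟩, ψ, ψ.contMDiff, hψI, fun x hx ↦ hx.2,
      fun τ hτs hτ ↦ ?_⟩
    refine collarTransportable_of_trivialization hp.contMDiff hcB φ h₁ h₂ (lt_min hδ one_pos)
      (min_le_right _ _) hG (isClosed_tsupport ψ) hψ (fun x hx t ht ↦ ?_) hτ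
      (fun x ↦ add_mul_one_sub_mem_Icc (hτ x) (hψI x)) hτs
      (hτs.add (ψ.contMDiff.mul (contMDiff_const.sub hτs))) (fun x hx ↦ ?_)
    · refine hUT (mk_mem_prod (hGU hx.2) (hδT ?_))
        ⟨hx.1, ht.1, ht.2.trans_le (min_le_right _ _)⟩
      simpa [abs_of_nonneg ht.1] using ht.2.trans_le (min_le_left _ _)
    · simp [image_eq_zero_of_notMem_tsupport hx]

/-! ### Shrinking a collar and lifting it to the total space -/

theorem mul_mem_Ico_zero {α t : ℝ} (hα : 0 < α) (ht : t ∈ Ico (0 : ℝ) 1) : α * t ∈ Ico 0 α :=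
  ⟨mul_nonneg hα.le ht.1, mul_lt_of_lt_one_right hα ht.2⟩

/-- The part of a collar up to time `α` is the preimage of `[0, α)` under the time coordinate. -/
theorem image_collarDomain_rescale {c : B × ℝ → B} {s : B → ℝ}
    (hs : ∀ x ∈ I.boundary B, ∀ t ∈ Ico (0 : ℝ) 1, s (c (x, t)) = t) {α : ℝ}
    (hα : α ∈ Ioc (0 : ℝ) 1) :
    (fun q : B × ℝ ↦ c (q.1, α * q.2)) '' collarDomain I B =
      c '' collarDomain I B ∩ s ⁻¹' Iio α := by
  ext b
  constructor
  · rintro ⟨⟨x, t⟩, ⟨hx, ht⟩, rfl⟩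
    have ht' := mul_mem_Ico_zero hα.1 ht
    have ht'' := Ico_subset_Ico_right hα.2 ht'
    refine ⟨⟨(x, α * t), ⟨hx, ht''⟩, rfl⟩, ?_⟩
    simpa [hs x hx _ ht''] using ht'.2
  · rintro ⟨⟨⟨x, t⟩, ⟨hx, ht⟩, rfl⟩, hb⟩
    rw [mem_preimage, hs x hx t ht] at hb
    refine ⟨(x, t / α), ⟨hx, div_nonneg ht.1 hα.1.le, (div_lt_one hα.1).2 hb⟩, ?_⟩
    simp only
    rw [mul_div_cancel₀ _ hα.1.ne']

theorem contMDiff_rescale (α : ℝ) : ContMDiff (I.prod 𝓘(ℝ, ℝ)) (I.prod 𝓘(ℝ, ℝ)) ∞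
    (fun q : B × ℝ ↦ (q.1, α * q.2)) :=
  contMDiff_fst.prodMk ((contMDiff_const (c := α)).mul contMDiff_snd)

/-- Shrinking a collar gives a collar. -/
theorem IsCollar.rescale {c : B × ℝ → B} (hc : IsCollar I c) {α : ℝ} (hα : α ∈ Ioc (0 : ℝ) 1) :
    IsCollar I (fun q ↦ c (q.1, α * q.2)) := by
  obtain ⟨r, s, hr, hs, hrs⟩ := hc.exists_projections
  have him := image_collarDomain_rescale (fun x hx t ht ↦ (hrs x hx t ht).2) hα
  refine ⟨fun x hx ↦ by simpa using hc.apply_zero x hx, ?_, ?_, fun b ↦ (r b, s b / α), ?_, ?_⟩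
  · exact hc.contMDiffOn.comp (contMDiff_rescale α).contMDiffOn fun q hq ↦
      ⟨hq.1, Ico_subset_Ico_right hα.2 (mul_mem_Ico_zero hα.1 hq.2)⟩
  · rw [him]
    exact hs.continuousOn.isOpen_inter_preimage hc.isOpen_image isOpen_Iio
  · rintro ⟨x, t⟩ ⟨hx, ht⟩
    obtain ⟨h1, h2⟩ := hrs x hx (α * t) (Ico_subset_Ico_right hα.2 (mul_mem_Ico_zero hα.1 ht))
    simp [h1, h2, hα.1.ne']
  · rw [him]
    exact (hr.prodMk (hs.div_const α)).mono inter_subset_left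

/-- Every sufficiently short collar of the base of a smooth fibre bundle lifts to the total
space. -/
theorem IsCollar.exists_pRelated [FiniteDimensional ℝ V] [IsManifold I ∞ B] [T2Space B]
    [CompactSpace B] [BoundarylessManifold K L] (hp : IsSmoothFiberBundle I J K L p)
    (hcB : IsCollar I cB) :
    ∃ α ∈ Ioc (0 : ℝ) 1, ∃ cE : E × ℝ → E, PRelated I J p cE (fun q ↦ cB (q.1, α * q.2)) := by
  obtain ⟨α, hα, χ, hχ, Q, Q', hQ, hQ', hQQ', hQ'Q⟩ := exists_collarTransportable hp hcB
  obtain ⟨r, s, hr, hs, hrs⟩ := hcB.exists_projections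
  have hcB' := hcB.rescale hα
  have hbd := hp.mem_boundary_iff
  -- For `τ = 0` the collar graph is `∂E × [0, α)`, the source of the transport.
  have hp0 : ∀ e ∈ J.boundary E, ∀ t, p e = cB (p e, 0 * t) := fun e he t ↦ by
    rw [zero_mul, hcB.apply_zero _ ((hbd e).1 he)]
  have hΓ : MapsTo (fun q : E × ℝ ↦ (q.1, α * q.2)) (collarDomain J E)
      (collarGraph I p cB α fun _ ↦ 0) := fun q hq ↦
    ⟨mul_mem_Ico_zero hα.1 hq.2, p q.1, (hbd _).1 hq.1, hp0 _ hq.1 _⟩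
  have hcomm : ∀ e ∈ J.boundary E, ∀ t ∈ Ico (0 : ℝ) 1,
      p (Q (e, α * t)) = cB (p e, α * t) := fun e he t ht ↦ by
    have := hQ.apply_proj (p e) ((hbd e).1 he) _ (mul_mem_Ico_zero hα.1 ht) e (hp0 e he _)
    rwa [hχ _ ((hbd e).1 he), one_mul] at this
  have hspE : ∀ e ∈ J.boundary E, ∀ t ∈ Ico (0 : ℝ) 1, s (p (Q (e, α * t))) = α * t :=
    fun e he t ht ↦ by
      rw [hcomm e he t ht]
      exact (hrs _ ((hbd e).1 he) _ (Ico_subset_Ico_right hα.2 (mul_mem_Ico_zero hα.1 ht))).2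
  have him := image_collarDomain_rescale (fun x hx t ht ↦ (hrs x hx t ht).2) hα
  have hΓ' : MapsTo (fun e ↦ (e, s (p e)))
      (p ⁻¹' ((fun q : B × ℝ ↦ cB (q.1, α * q.2)) '' collarDomain I B))
      (collarGraph I p cB α χ) := by
    rintro e ⟨⟨x, t⟩, ⟨hx, ht⟩, he⟩
    have ht' := mul_mem_Ico_zero hα.1 ht
    have hse : s (p e) = α * t := by
      rw [← he]; exact (hrs x hx _ (Ico_subset_Ico_right hα.2 ht')).2
    refine ⟨by simpa only [hse] using ht', x, hx, ?_⟩
    change p e = cB (x, χ x * s (p e))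
    rw [hse, hχ x hx, one_mul, ← he]
  -- The image is the whole preimage of the shrunken base collar, hence open: the reverse transport
  -- moves any point over `cB (x, α * t)` to one over `x`, which lies in `∂E`.
  have himE : (fun q : E × ℝ ↦ Q (q.1, α * q.2)) '' collarDomain J E =
      p ⁻¹' ((fun q : B × ℝ ↦ cB (q.1, α * q.2)) '' collarDomain I B) := by
    ext e
    constructor
    · rintro ⟨⟨e', t⟩, ⟨he', ht⟩, rfl⟩
      exact ⟨(p e', t), ⟨(hbd e').1 he', ht⟩, (hcomm e' he' t ht).symm⟩
    · intro he
      have hmem := hΓ' he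
      obtain ⟨⟨x, t⟩, ⟨hx, ht⟩, het⟩ := he
      have ht' := mul_mem_Ico_zero hα.1 ht
      have hse : s (p e) = α * t := by
        rw [← het]; exact (hrs x hx _ (Ico_subset_Ico_right hα.2 ht')).2
      have h1 : p (Q' (e, α * t)) = x := by
        rw [hQ'.apply_proj x hx _ ht' e (by rw [← het, hχ x hx, one_mul]), zero_mul,
          hcB.apply_zero x hx]
      refine ⟨(Q' (e, α * t), t), ⟨(hbd _).2 (by rwa [h1]), ht⟩, ?_⟩
      simp only [hse] at hmem
      exact hQ'Q _ hmem
  refine ⟨α, hα, fun q ↦ Q (q.1, α * q.2), ?_, hcB', fun e he ↦ (hbd e).1 he, hcomm⟩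
  refine ⟨fun e he ↦ ?_, hQ.contMDiffOn.comp (contMDiff_rescale α).contMDiffOn hΓ, ?_,
    -- The time of a point of `E` is read off from its projection by `s`; the reverse transport for
    -- that time recovers the boundary point.
    fun e ↦ (Q' (e, s (p e)), s (p e) / α), ?_, ?_⟩
  · simpa using hQ.apply_zero e ((hbd e).1 he)
  · rw [himE]
    exact hcB'.isOpen_image.preimage hp.contMDiff.continuous
  · rintro ⟨e, t⟩ ⟨he, ht⟩
    simp only [hspE e he t ht]
    refine Prod.ext (hQQ' (e, α * t) (hΓ ⟨he, ht⟩)) ?_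
    simp only
    rw [mul_div_cancel_left₀ _ hα.1.ne']
  · rw [himE]
    have hsp : ContMDiffOn J 𝓘(ℝ, ℝ) ∞ (fun e ↦ s (p e))
        (p ⁻¹' ((fun q : B × ℝ ↦ cB (q.1, α * q.2)) '' collarDomain I B)) :=
      hs.comp hp.contMDiff.contMDiffOn fun e he ↦ by
        rw [mem_preimage, him] at he
        exact he.1
    exact (hQ'.contMDiffOn.comp (contMDiffOn_id.prodMk hsp) hΓ').prodMk (hsp.div_const α)

theorem isDiffeoBetween_mul_left {α : ℝ} (hα : 0 < α) :
    IsDiffeoBetween (fun t ↦ α * t) (Ico 0 1) (Ico 0 α) := by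
  refine ⟨⟨fun t ht ↦ mul_mem_Ico_zero hα ht, fun t _ t' _ h ↦ mul_left_cancel₀ hα.ne' h,
    fun t ht ↦ ⟨t / α, ⟨div_nonneg ht.1 hα.le, (div_lt_one hα).2 ht.2⟩, ?_⟩⟩, ?_,
    fun t ↦ t / α, fun t _ ↦ ?_, ?_⟩
  · simp only
    rw [mul_div_cancel₀ _ hα.ne']
  · fun_prop
  · simp only
    rw [mul_div_cancel_left₀ _ hα.ne']
  · fun_prop

end BundleCollar

/-! ### The theorem -/

theorem mainTheorem6
    {V H B : Type*} [NormedAddCommGroup V] [NormedSpace ℝ V] [FiniteDimensional ℝ V]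
    [TopologicalSpace H] (I : ModelWithCorners ℝ V H) (hI : IsHalfSpaceModel I)
    [TopologicalSpace B] [ChartedSpace H B] [IsManifold I ∞ B] [T2Space B] [CompactSpace B]
    {V' H' E : Type*} [NormedAddCommGroup V'] [NormedSpace ℝ V'] [FiniteDimensional ℝ V']
    [TopologicalSpace H'] (J : ModelWithCorners ℝ V' H') (hJ : IsHalfSpaceModel J)
    [TopologicalSpace E] [ChartedSpace H' E] [IsManifold J ∞ E] [T2Space E]
    {V'' H'' L : Type*} [NormedAddCommGroup V''] [NormedSpace ℝ V''] [FiniteDimensional ℝ V'']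
    [TopologicalSpace H''] (K : ModelWithCorners ℝ V'' H'')
    [TopologicalSpace L] [ChartedSpace H'' L] [IsManifold K ∞ L] [T2Space L] [CompactSpace L]
    [BoundarylessManifold K L]
    (p : E → B) (hp : IsSmoothFiberBundle I J K L p) :
    (∃ (cE : E × ℝ → E) (cB : B × ℝ → B), PRelated I J p cE cB) ∧
    (∀ cB : B × ℝ → B, IsCollar I cB →
      ∃ (α : ℝ) (f : ℝ → ℝ) (cE : E × ℝ → E), α ∈ Ioc (0 : ℝ) 1 ∧
        IsDiffeoBetween f (Ico 0 1) (Ico 0 α) ∧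
        PRelated I J p cE (fun x => cB (x.1, f x.2))) := by
  have key : ∀ cB : B × ℝ → B, IsCollar I cB →
      ∃ (α : ℝ) (f : ℝ → ℝ) (cE : E × ℝ → E), α ∈ Ioc (0 : ℝ) 1 ∧
        IsDiffeoBetween f (Ico 0 1) (Ico 0 α) ∧
        PRelated I J p cE (fun x => cB (x.1, f x.2)) := by
    intro cB hcB
    obtain ⟨α, hα, cE, h⟩ := hcB.exists_pRelated hp
    exact ⟨α, fun t ↦ α * t, cE, hα, isDiffeoBetween_mul_left hα.1, h⟩
  obtain ⟨cB, hcB⟩ := exists_isCollar (M := B) hI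
  obtain ⟨α, f, cE, -, -, h⟩ := key cB hcB
  exact ⟨⟨cE, _, h⟩, key⟩
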